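/- There is a universal constant $c_1>0$ such that the following holds for all integers $d\ge 1$, $n\ge 1$ and all real $q\ge 1$. For an order-$d$ tensor $T\in\mathbb R^{n\times\cdots\times n}$ let $$\|T\|_2=\sup_{\|x_1\|_2=\cdots=\|x_d\|_2=1}\Big|\sum_{i_1,\dots,i_d=1}^n T_{i_1\cdots i_d}\,(x_1)_{i_1}\cdots(x_d)_{i_d}\Big|$$ be its spectral norm and $\|T\|_F=\big(\sum_{i_1,\dots,i_d} T_{i_1\cdots i_d}^2\big)^{1/2}$ its Frobenius norm. (i) Let $\mathcal B\in\mathbb R^{n\times\cdots\times n}$ be a random order-$d$ tensor whose entries are independent, integrable, zero-mean random variables. Then $$\big(\mathbb E\|\mathcal B\|_2^q\big)^{1/q}\le c_1\,2^{3(d-1)}\big(\sqrt{d\ln n}+\sqrt q\big)\Big(\sum_{j=1}^d\mathbb E\max_{i_1,\dots,i_{j-1},i_{j+1},\dots,i_d}\Big(\sum_{i_j=1}^n\mathcal B_{i_1\cdots i_d}^2\Big)^{q/2}\Big)^{1/q},$$ where both sides are read in $[0,\infty]$. (ii) In particular, with the same $c_1$, the inequality in (i) holds for $\mathcal B=\mathcal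 A^{[1]}-\widetilde{\mathcal A}^{[1]}$, where $\mathcal A\in\mathbb R^{n\times\cdots\times n}$ is a fixed order-$d$ tensor, $s>0$ is real, $\mathcal A^{[1]}$ consists of the entries of $\mathcal A$ with $\mathcal A_{i_1\cdots i_d}^2\ge \frac12\|\mathcal A\|_F^2/s$ (all other entries being set to zero), and $\widetilde{\mathcal A}^{[1]}$ is the random tensor obtained from $\mathcal A^{[1]}$ by keeping each entry, independently, with probability $p_{i_1\cdots i_d}=\min\{1,\ s\mathcal A_{i_1\cdots i_d}^2/\|\mathcal A\|_F^2\}$, dividing it by $p_{i_1\cdots i_d}$ if it is kept, and setting it to zero otherwise. (For $\mathcal A=0$, all these tensors are zero.) -/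

import Mathlib

open MeasureTheory ProbabilityTheory

namespace RandomTensor

/-- Real tensors of order `d` all of whose modes have dimension `n`. -/
abbrev Tensor (d n : ℕ) : Type := (Fin d → Fin n) → ℝ

/-- The full contraction of a tensor with one vector in each mode:
`∑ T (i₁, …, i_d) * x₁ (i₁) * ⋯ * x_d (i_d)`. -/
def contract {d n : ℕ} (T : Tensor d n) (x : Fin d → EuclideanSpace ℝ (Fin n)) : ℝ :=
  ∑ i : Fin d → Fin n, T i * ∏ k : Fin d, x k (i k)

/-- The spectral norm: the supremum of the absolute value of the full contraction over
Euclidean unit vectors (a supremum of a bounded set of reals, nonempty when `1 ≤ n`). -/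
noncomputable def specNorm {d n : ℕ} (T : Tensor d n) : ℝ :=
  sSup {r : ℝ | ∃ x : Fin d → EuclideanSpace ℝ (Fin n),
    (∀ k, ‖x k‖ = 1) ∧ r = |contract T x|}

/-- The Frobenius norm. -/
noncomputable def frobNorm {d n : ℕ} (T : Tensor d n) : ℝ :=
  Real.sqrt (∑ i : Fin d → Fin n, (T i) ^ 2)

/-- The maximum, over all values of the indices other than the `j`-th, of
`(∑ over the j-th index of the squared entries) ^ (q / 2)`. The supremum runs over full
multi-indices `i`, but the `j`-th coordinate of `i` is overwritten by the summation index,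
so that it has no influence; the index set is finite. -/
noncomputable def maxFiber {d n : ℕ} (q : ℝ) (j : Fin d) (T : Tensor d n) : ℝ :=
  ⨆ i : Fin d → Fin n, (∑ a : Fin n, (T (Function.update i j a)) ^ 2) ^ (q / 2)

/-- `(E ‖B‖₂ ^ q) ^ (1 / q)`, as an extended nonnegative real number. -/
noncomputable def normMoment {d n : ℕ} {Ω : Type*} [MeasurableSpace Ω] (P : Measure Ω)
    (q : ℝ) (B : Ω → Tensor d n) : ENNReal :=
  (∫⁻ ω, ENNReal.ofReal (specNorm (B ω) ^ q) ∂P) ^ (1 / q)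

/-- `(∑ j, E max (∑ over the j-th index of B ^ 2) ^ (q / 2)) ^ (1 / q)`, as an extended
nonnegative real number. -/
noncomputable def fiberMoment {d n : ℕ} {Ω : Type*} [MeasurableSpace Ω] (P : Measure Ω)
    (q : ℝ) (B : Ω → Tensor d n) : ENNReal :=
  (∑ j : Fin d, ∫⁻ ω, ENNReal.ofReal (maxFiber q j (B ω)) ∂P) ^ (1 / q)

open Classical in
/-- The tensor `A^[1]`: the entries of `A` with square at least `‖A‖_F ^ 2 / (2 s)`, all
others being replaced by zero. -/
noncomputable def largePart {d n : ℕ} (s : ℝ) (A : Tensor d n) : Tensor d n :=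
  fun i => if (A i) ^ 2 ≥ 2⁻¹ * (frobNorm A ^ 2 / s) then A i else 0

/-- The probability with which the entry with index `i` is kept by the sampling:
`s * A i ^ 2 / ‖A‖_F ^ 2` if this is less than one, and one otherwise. -/
noncomputable def keepProb {d n : ℕ} (s : ℝ) (A : Tensor d n) (i : Fin d → Fin n) : ℝ :=
  min 1 (s * (A i) ^ 2 / frobNorm A ^ 2)

/-- The sampled and rescaled version of `A^[1]`; `δ i` is one if the entry with index `i` is
kept and zero otherwise. -/
noncomputable def sampledLargePart {d n : ℕ} (s : ℝ) (A : Tensor d n)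
    (δ : (Fin d → Fin n) → ℝ) : Tensor d n :=
  fun i => δ i * largePart s A i / keepProb s A i

end RandomTensor

/-! Signs can be inserted at bounded cost. Split the indices by a fixed sign pattern: `B` is then a
difference of two restrictions of the signed tensor, and by Jensen deleting independent centered
entries does not raise the moments, so `lintegral_specNorm_le_signed` holds for each pattern.
Averaging over all patterns leaves a deterministic `T` whose fibers have Euclidean norm at most `R`,
multiplied by Rademacher signs (`sum_specNorm_signed_rpow_le`).

There the unit vectors are replaced by arrays of signed dyadic numbers (`exists_dyadic_form_ge`).
For one array `y` the signed form is sub-Gaussian with variance `formVar T y`, and at most `exp (N *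
l)` arrays have `N` nonzero entries, where `l = log (2dn(n+1))`. A weighted union bound
(`partitionSum`, `abs_form_signed_le`) bounds all forms at once by `√(formVar T y * (N * l + q))`,
up to one random factor whose L^q norm is bounded by an absolute constant.

Applied to a whole array this is too weak, since `N` can be as large as `dn`. Each product is
therefore split by the mode `j` and the level `2⁻ᵏ` of its smallest factor. In the piece `(j, k)`
the `j`-th factor is `±2⁻ᵏ`, so the variances weighted by `4ᵏ` have a sum of order `R²`
(`sum_formVar_pieces_le`); all nonzero entries are at least `2⁻ᵏ` in modulus, so the support sizes
weighted by `4⁻ᵏ` are controlled by the squared norms (`sum_suppSize_pieces_le`). Cauchy–Schwarz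
over the pieces combines both sums without a factor for the number of levels
(`abs_form_le_of_dyadic`). -/

namespace RandomTensor

/-! ### Dyadic discretization of the unit vectors -/

/-- The full contraction of a tensor with an array of `d` vectors of length `n`. -/
def form {d n : ℕ} (T : Tensor d n) (y : Fin d × Fin n → ℝ) : ℝ :=
  ∑ i : Fin d → Fin n, T i * ∏ k : Fin d, y (k, i k)

/-- The variance of `form (ε * T) y` for independent random signs `ε`. -/
def formVar {d n : ℕ} (T : Tensor d n) (y : Fin d × Fin n → ℝ) : ℝ :=
  ∑ i : Fin d → Fin n, (T i * ∏ k : Fin d, y (k, i k)) ^ 2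

/-- The number of nonzero entries of an array. -/
noncomputable def suppSize {d n : ℕ} (y : Fin d × Fin n → ℝ) : ℝ :=
  ∑ p, if y p = 0 then 0 else 1

/-- Zero and the signed dyadic numbers `± 2⁻ᵏ` with `k ≤ n`. -/
noncomputable def dyadics (n : ℕ) : Finset ℝ :=
  insert 0 ((Finset.range (n + 1)).image (fun k => (2⁻¹ : ℝ) ^ k) ∪
    (Finset.range (n + 1)).image (fun k => -(2⁻¹ : ℝ) ^ k))

lemma mem_dyadics {n : ℕ} {t : ℝ} :
    t ∈ dyadics n ↔ t = 0 ∨ ∃ k, k ≤ n ∧ |t| = (2⁻¹ : ℝ) ^ k := by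
  have hpos : ∀ k : ℕ, (0 : ℝ) < (2⁻¹ : ℝ) ^ k := fun k => by positivity
  simp only [dyadics, Finset.mem_insert, Finset.mem_union, Finset.mem_image, Finset.mem_range,
    Nat.lt_succ_iff]
  constructor
  · rintro (h | ⟨k, hk, rfl⟩ | ⟨k, hk, rfl⟩)
    · exact Or.inl h
    · exact Or.inr ⟨k, hk, abs_of_pos (hpos k)⟩
    · exact Or.inr ⟨k, hk, by rw [abs_neg, abs_of_pos (hpos k)]⟩
  · rintro (h | ⟨k, hk, h⟩)
    · exact Or.inl h
    · rcases (abs_eq (hpos k).le).1 h with h | h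
      · exact Or.inr (Or.inl ⟨k, hk, h.symm⟩)
      · exact Or.inr (Or.inr ⟨k, hk, h.symm⟩)

lemma neg_mem_dyadics {n : ℕ} {t : ℝ} (h : t ∈ dyadics n) : -t ∈ dyadics n := by
  rw [mem_dyadics] at h ⊢
  simpa using h

lemma zero_mem_dyadics (n : ℕ) : (0 : ℝ) ∈ dyadics n := mem_dyadics.2 (Or.inl rfl)

/-- Neighbouring positive levels differ by a factor two, so rounding at most doubles `t`. Below the
last level the bracket is `[0, 2⁻ⁿ]`, which costs the additive `4⁻ⁿ`. -/
lemma exists_dyadic_bracket_of_nonneg (n : ℕ) {t : ℝ} (h0 : 0 ≤ t) (h1 : t ≤ 1) :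
    ∃ lo ∈ dyadics n, ∃ hi ∈ dyadics n, lo ≤ t ∧ t ≤ hi ∧
      lo ^ 2 ≤ 4 * t ^ 2 + (4⁻¹ : ℝ) ^ n ∧ hi ^ 2 ≤ 4 * t ^ 2 + (4⁻¹ : ℝ) ^ n := by
  classical
  have hmem : ∀ k, k ≤ n → (2⁻¹ : ℝ) ^ k ∈ dyadics n := fun k hk =>
    mem_dyadics.2 (Or.inr ⟨k, hk, abs_of_pos (by positivity)⟩)
  have h4 : (0 : ℝ) < (4⁻¹ : ℝ) ^ n := by positivity
  by_cases ht : (2⁻¹ : ℝ) ^ n ≤ t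
  · have hex : ∃ k : ℕ, (2⁻¹ : ℝ) ^ k ≤ t := ⟨n, ht⟩
    have hk := Nat.find_spec hex
    have hkn : Nat.find hex ≤ n := Nat.find_min' hex ht
    have hmin : ∀ m, m < Nat.find hex → ¬ (2⁻¹ : ℝ) ^ m ≤ t := fun m hm => Nat.find_min hex hm
    generalize Nat.find hex = k at hk hkn hmin
    have hp : (0 : ℝ) < (2⁻¹ : ℝ) ^ k := by positivity
    refine ⟨_, hmem k hkn, ?_⟩
    rcases Nat.eq_zero_or_pos k with rfl | hkpos
    · refine ⟨_, hmem 0 hkn, hk, by simpa using h1, ?_, ?_⟩ <;> nlinarith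
    · obtain ⟨m, rfl⟩ : ∃ m, k = m + 1 := ⟨k - 1, by omega⟩
      have hm := hmin m (by omega)
      have hdouble : (2⁻¹ : ℝ) ^ m = 2 * (2⁻¹ : ℝ) ^ (m + 1) := by rw [pow_succ]; ring
      refine ⟨_, hmem m (by omega), hk, (not_le.1 hm).le, ?_, ?_⟩
      · nlinarith
      · rw [hdouble]; nlinarith
  · have h2 : ((2⁻¹ : ℝ) ^ n) ^ 2 = (4⁻¹ : ℝ) ^ n := by
      rw [← pow_mul, mul_comm, pow_mul]; norm_num
    refine ⟨0, zero_mem_dyadics n, _, hmem n le_rfl, h0, (not_le.1 ht).le, ?_, ?_⟩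
    · simp only [ne_eq, OfNat.ofNat_ne_zero, not_false_eq_true, zero_pow]; positivity
    · rw [h2]; nlinarith [sq_nonneg t]

lemma exists_dyadic_bracket (n : ℕ) {t : ℝ} (h1 : |t| ≤ 1) :
    ∃ lo ∈ dyadics n, ∃ hi ∈ dyadics n, lo ≤ t ∧ t ≤ hi ∧
      lo ^ 2 ≤ 4 * t ^ 2 + (4⁻¹ : ℝ) ^ n ∧ hi ^ 2 ≤ 4 * t ^ 2 + (4⁻¹ : ℝ) ^ n := by
  rcases le_total 0 t with h | h
  · exact exists_dyadic_bracket_of_nonneg n h ((le_abs_self t).trans h1)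
  · obtain ⟨lo, hlo, hi, hhi, a, b, c, e⟩ :=
      exists_dyadic_bracket_of_nonneg n (neg_nonneg.2 h) ((neg_le_abs t).trans h1)
    refine ⟨-hi, neg_mem_dyadics hhi, -lo, neg_mem_dyadics hlo, by linarith, by linarith, ?_, ?_⟩
    · simpa using e
    · simpa using c

/-- An affine function of one real variable is largest in modulus at an endpoint. -/
lemma abs_affine_le_endpoint {A B lo hi t : ℝ} (h1 : lo ≤ t) (h2 : t ≤ hi) :
    |A * t + B| ≤ |A * lo + B| ∨ |A * t + B| ≤ |A * hi + B| := by
  by_contra! h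
  have h3 := h.1
  have h4 := h.2
  rcases le_total 0 A with hA | hA
  · have e1 : A * lo ≤ A * t := mul_le_mul_of_nonneg_left h1 hA
    have e2 : A * t ≤ A * hi := mul_le_mul_of_nonneg_left h2 hA
    rcases le_total 0 (A * t + B) with h5 | h5
    · rw [abs_of_nonneg h5, abs_of_nonneg (by linarith : 0 ≤ A * hi + B)] at h4; linarith
    · rw [abs_of_nonpos h5, abs_of_nonpos (by linarith : A * lo + B ≤ 0)] at h3; linarith
  · have e1 : A * t ≤ A * lo := mul_le_mul_of_nonpos_left h1 hA
    have e2 : A * hi ≤ A * t := mul_le_mul_of_nonpos_left h2 hA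
    rcases le_total 0 (A * t + B) with h5 | h5
    · rw [abs_of_nonneg h5, abs_of_nonneg (by linarith : 0 ≤ A * lo + B)] at h3; linarith
    · rw [abs_of_nonpos h5, abs_of_nonpos (by linarith : A * hi + B ≤ 0)] at h4; linarith

/-- A multi-affine function on a box is largest in modulus at a vertex. -/
lemma exists_vertex_of_multiaffine {ι : Type*} [DecidableEq ι] (f : (ι → ℝ) → ℝ)
    (hf : ∀ x p, ∃ A B : ℝ, ∀ t, f (Function.update x p t) = A * t + B)
    (x lo hi : ι → ℝ) (hlo : ∀ p, lo p ≤ x p) (hhi : ∀ p, x p ≤ hi p) (s : Finset ι) :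
    ∃ c : ι → ℝ, (∀ p ∈ s, c p = lo p ∨ c p = hi p) ∧ (∀ p ∉ s, c p = x p) ∧ |f x| ≤ |f c| := by
  induction s using Finset.induction_on with
  | empty => exact ⟨x, by simp, by simp, le_rfl⟩
  | insert a s ha ih =>
    obtain ⟨c, h1, h2, h3⟩ := ih
    obtain ⟨A, B, hAB⟩ := hf c a
    have hc : f c = A * x a + B := by
      rw [← h2 a ha, ← hAB, Function.update_eq_self]
    have key : ∀ t, (t = lo a ∨ t = hi a) → |f c| ≤ |A * t + B| →
        ∃ c : ι → ℝ, (∀ p ∈ insert a s, c p = lo p ∨ c p = hi p) ∧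
          (∀ p ∉ insert a s, c p = x p) ∧ |f x| ≤ |f c| := by
      intro t ht hle
      refine ⟨Function.update c a t, ?_, ?_, ?_⟩
      · intro p hp
        by_cases hpa : p = a
        · subst hpa; simpa using ht
        · rw [Function.update_of_ne hpa]
          exact h1 p ((Finset.mem_insert.1 hp).resolve_left hpa)
      · intro p hp
        rw [Finset.mem_insert, not_or] at hp
        rw [Function.update_of_ne hp.1]
        exact h2 p hp.2
      · rw [hAB]; exact h3.trans hle
    rw [hc] at key
    rcases abs_affine_le_endpoint (A := A) (B := B) (hlo a) (hhi a) with h | h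
    · exact key _ (Or.inl rfl) h
    · exact key _ (Or.inr rfl) h

/-- A monomial uses exactly one entry from each mode, hence no entry twice. -/
lemma form_update_affine {d n : ℕ} (T : Tensor d n) (x : Fin d × Fin n → ℝ) (p : Fin d × Fin n) :
    ∃ A B : ℝ, ∀ t, form T (Function.update x p t) = A * t + B := by
  classical
  have h : ∀ i : Fin d → Fin n, ∃ A B : ℝ, ∀ t,
      T i * ∏ k : Fin d, Function.update x p t (k, i k) = A * t + B := by
    intro i
    by_cases hi : i p.1 = p.2
    · refine ⟨T i * ∏ k ∈ Finset.univ.erase p.1, x (k, i k), 0, fun t => ?_⟩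
      rw [← Finset.mul_prod_erase _ _ (Finset.mem_univ p.1)]
      have h1 : Function.update x p t (p.1, i p.1) = t := by
        rw [hi]; simp
      have h2 : ∏ k ∈ Finset.univ.erase p.1, Function.update x p t (k, i k)
          = ∏ k ∈ Finset.univ.erase p.1, x (k, i k) := by
        refine Finset.prod_congr rfl fun k hk => Function.update_of_ne ?_ _ _
        intro hkp
        exact (Finset.mem_erase.1 hk).1 (congrArg Prod.fst hkp)
      rw [h1, h2]; ring
    · refine ⟨0, T i * ∏ k, x (k, i k), fun t => ?_⟩
      have h2 : ∏ k, Function.update x p t (k, i k) = ∏ k, x (k, i k) := by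
        refine Finset.prod_congr rfl fun k _ => Function.update_of_ne ?_ _ _
        rintro rfl
        exact hi rfl
      rw [h2]; ring
  choose A B hAB using h
  refine ⟨∑ i, A i, ∑ i, B i, fun t => ?_⟩
  simp only [form, hAB, Finset.sum_add_distrib, Finset.sum_mul]

/-- The contraction with unit vectors is dominated by a contraction with dyadic arrays. -/
lemma exists_dyadic_form_ge {d n : ℕ} (T : Tensor d n) (x : Fin d → EuclideanSpace ℝ (Fin n))
    (hx : ∀ k, ‖x k‖ = 1) :
    ∃ c : Fin d × Fin n → ℝ, (∀ p, c p ∈ dyadics n) ∧ (∀ j, ∑ a, c (j, a) ^ 2 ≤ 5) ∧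
      |contract T x| ≤ |form T c| := by
  classical
  have hsum : ∀ k, ∑ a, (x k a) ^ 2 = 1 := by
    intro k
    have := EuclideanSpace.norm_sq_eq (x k)
    rw [hx k] at this
    simpa using this.symm
  have habs : ∀ p : Fin d × Fin n, |x p.1 p.2| ≤ 1 := by
    intro p
    rw [← sq_le_one_iff_abs_le_one, ← hsum p.1]
    exact Finset.single_le_sum (f := fun a => (x p.1 a) ^ 2) (fun a _ => sq_nonneg _)
      (Finset.mem_univ p.2)
  choose lo hlo hi hhi h1 h2 h3 h4 using fun p => exists_dyadic_bracket n (habs p)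
  obtain ⟨c, hc, -, hle⟩ := exists_vertex_of_multiaffine (form T) (form_update_affine T)
    (fun p => x p.1 p.2) lo hi h1 h2 Finset.univ
  refine ⟨c, ?_, ?_, hle⟩
  · intro p
    rcases hc p (Finset.mem_univ p) with h | h <;> rw [h]
    exacts [hlo p, hhi p]
  · intro j
    have hb : ∀ a, c (j, a) ^ 2 ≤ 4 * (x j a) ^ 2 + (4⁻¹ : ℝ) ^ n := by
      intro a
      rcases hc (j, a) (Finset.mem_univ _) with h | h <;> rw [h]
      exacts [h3 (j, a), h4 (j, a)]
    -- This is why the levels may stop at `n`: the rounding errors of a whole vector add up to at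
    -- most one, giving `4 + 1 = 5`.
    have hn : (n : ℝ) * (4⁻¹ : ℝ) ^ n ≤ 1 := by
      rw [inv_pow, mul_inv_le_iff₀ (by positivity), one_mul]
      exact_mod_cast (Nat.lt_pow_self (by norm_num : 1 < 4)).le
    calc ∑ a, c (j, a) ^ 2 ≤ ∑ a, (4 * (x j a) ^ 2 + (4⁻¹ : ℝ) ^ n) :=
          Finset.sum_le_sum fun a _ => hb a
      _ = 4 + n * (4⁻¹ : ℝ) ^ n := by
          rw [Finset.sum_add_distrib, ← Finset.mul_sum, hsum]; simp
      _ ≤ 5 := by linarith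

/-! ### Splitting products by their smallest factor -/

open Classical in
/-- `pieceFactor j k m t` is `t` if `t` may be the `m`-th factor of a product of dyadic numbers
whose smallest factor is `2⁻ᵏ` in modulus and is first attained at `j`, and zero otherwise. -/
noncomputable def pieceFactor {d : ℕ} (j : Fin d) (k : ℕ) (m : Fin d) (t : ℝ) : ℝ :=
  if (m = j → |t| = (2⁻¹ : ℝ) ^ k) ∧ (m < j → (2⁻¹ : ℝ) ^ k < |t|) ∧ (2⁻¹ : ℝ) ^ k ≤ |t|
  then t else 0

lemma prod_eq_sum_pieces {d n : ℕ} (hd : 1 ≤ d) (u : Fin d → ℝ) (hu : ∀ j, u j ∈ dyadics n) :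
    ∏ m, u m = ∑ j : Fin d, ∑ k ∈ Finset.range (n + 1), ∏ m, pieceFactor j k m (u m) := by
  classical
  by_cases h0 : ∃ m, u m = 0
  · obtain ⟨m, hm⟩ := h0
    rw [Finset.prod_eq_zero (Finset.mem_univ m) hm]
    symm
    refine Finset.sum_eq_zero fun j _ => Finset.sum_eq_zero fun k _ => ?_
    refine Finset.prod_eq_zero (Finset.mem_univ m) ?_
    simp [pieceFactor, hm]
  push Not at h0
  have : Nonempty (Fin d) := ⟨⟨0, hd⟩⟩
  -- The lexicographic order breaks ties in favour of the first mode, so exactly one pair `(j, k)`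
  -- yields a nonzero product.
  obtain ⟨j₀, -, hj₀⟩ := Finset.exists_min_image (Finset.univ : Finset (Fin d))
    (fun j => toLex (|u j|, j)) Finset.univ_nonempty
  have hmin : ∀ m, |u j₀| < |u m| ∨ (|u j₀| = |u m| ∧ j₀ ≤ m) := by
    intro m
    have := hj₀ m (Finset.mem_univ m)
    rw [Prod.Lex.toLex_le_toLex] at this
    exact this
  obtain ⟨k₀, hk₀, huk⟩ := (mem_dyadics.1 (hu j₀)).resolve_left (h0 j₀)
  rw [Finset.sum_eq_single j₀, Finset.sum_eq_single k₀]
  · refine Finset.prod_congr rfl fun m _ => ?_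
    rw [pieceFactor, if_pos]
    rw [← huk]
    refine ⟨fun h => by rw [h], fun h => ?_, ?_⟩
    · rcases hmin m with h' | h'
      · exact h'
      · exact absurd h'.2 (not_le.2 h)
    · rcases hmin m with h' | h'
      exacts [h'.le, h'.1.le]
  · intro k _ hk
    refine Finset.prod_eq_zero (Finset.mem_univ j₀) ?_
    rw [pieceFactor, if_neg]
    rintro ⟨h, -⟩
    have := h rfl
    rw [huk] at this
    exact hk (pow_right_injective₀ (by norm_num) (by norm_num) this).symm
  · intro h
    exact absurd (Finset.mem_range.2 (Nat.lt_succ_of_le hk₀)) h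
  · intro j _ hj
    refine Finset.sum_eq_zero fun k _ => ?_
    by_contra hne
    have hall : ∀ m, pieceFactor j k m (u m) ≠ 0 := fun m hm =>
      hne (Finset.prod_eq_zero (Finset.mem_univ m) hm)
    have hcond : ∀ m, (m = j → |u m| = (2⁻¹ : ℝ) ^ k) ∧ (m < j → (2⁻¹ : ℝ) ^ k < |u m|) ∧
        (2⁻¹ : ℝ) ^ k ≤ |u m| := by
      intro m
      by_contra hc
      exact hall m (by rw [pieceFactor, if_neg hc])
    have e1 := (hcond j).1 rfl
    have e2 := hcond j₀
    rcases hmin j with h' | h'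
    · linarith [e2.2.2]
    · have := e2.2.1 (lt_of_le_of_ne h'.2 (Ne.symm hj))
      linarith [h'.1]
  · intro h
    exact absurd (Finset.mem_univ j₀) h

lemma pieceFactor_mem_dyadics {d n : ℕ} (j : Fin d) (k : ℕ) (m : Fin d) {t : ℝ}
    (ht : t ∈ dyadics n) : pieceFactor j k m t ∈ dyadics n := by
  unfold pieceFactor
  split_ifs
  exacts [ht, zero_mem_dyadics n]

lemma pieceFactor_sq_le {d : ℕ} (j : Fin d) (k : ℕ) (m : Fin d) (t : ℝ) :
    pieceFactor j k m t ^ 2 ≤ t ^ 2 := by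
  unfold pieceFactor
  split_ifs
  · exact le_rfl
  · simpa using sq_nonneg t

lemma inv_two_pow_sq (k : ℕ) : ((2⁻¹ : ℝ) ^ k) ^ 2 = (4⁻¹ : ℝ) ^ k := by
  rw [← pow_mul, mul_comm, pow_mul]; norm_num

/-- Only one level contributes to the sum. -/
lemma sum_four_pow_mul_pieceFactor_sq_le {d : ℕ} (j : Fin d) (N : ℕ) (t : ℝ) :
    ∑ k ∈ Finset.range N, 4 ^ k * pieceFactor j k j t ^ 2 ≤ 1 := by
  classical
  by_cases h : ∃ k ∈ Finset.range N, pieceFactor j k j t ≠ 0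
  · obtain ⟨k, hk, hne⟩ := h
    have habs : ∀ k, pieceFactor j k j t ≠ 0 → |t| = (2⁻¹ : ℝ) ^ k := by
      intro k hne
      by_contra hc
      exact hne (by rw [pieceFactor, if_neg]; exact fun h => hc (h.1 rfl))
    rw [Finset.sum_eq_single k]
    · have h1 := pieceFactor_sq_le j k j t
      rw [← sq_abs t, habs k hne, inv_two_pow_sq] at h1
      calc (4 : ℝ) ^ k * pieceFactor j k j t ^ 2 ≤ 4 ^ k * (4⁻¹ : ℝ) ^ k := by gcongr
        _ = 1 := by rw [← mul_pow]; norm_num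
    · intro l _ hl
      by_contra hc
      have hl' : pieceFactor j l j t ≠ 0 := fun h => hc (by rw [h]; simp)
      have := (habs l hl').symm.trans (habs k hne)
      exact hl (pow_right_injective₀ (by norm_num) (by norm_num) this)
    · exact fun h => absurd hk h
  · push Not at h
    rw [Finset.sum_eq_zero]
    · norm_num
    · intro k hk
      rw [h k hk]; simp

lemma sum_four_pow_inv_le (N k₀ : ℕ) :
    ∑ k ∈ Finset.range N, (if k₀ ≤ k then (4⁻¹ : ℝ) ^ k else 0) ≤ 4 / 3 * (4⁻¹ : ℝ) ^ k₀ := by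
  -- The missing tail of the geometric series is kept in the bound to make the induction close.
  have h : ∀ N, ∑ k ∈ Finset.range N, (if k₀ ≤ k then (4⁻¹ : ℝ) ^ k else 0) ≤
      4 / 3 * (4⁻¹ : ℝ) ^ k₀ - (if k₀ ≤ N then 4 / 3 * (4⁻¹ : ℝ) ^ N else 0) := by
    intro N
    induction N with
    | zero =>
      rcases Nat.eq_zero_or_pos k₀ with rfl | h
      · simp
      · rw [if_neg (by omega)]; simp
    | succ N ih =>
      rw [Finset.sum_range_succ]
      by_cases h : k₀ ≤ N
      · rw [if_pos h] at ih ⊢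
        rw [if_pos (by omega), pow_succ]; linarith
      · rw [if_neg h] at ih ⊢
        by_cases h' : k₀ ≤ N + 1
        · have : k₀ = N + 1 := by omega
          subst this
          rw [if_pos le_rfl, sub_self]
          rw [Finset.sum_eq_zero]
          · simp
          · intro k hk
            rw [Finset.mem_range] at hk
            rw [if_neg (by omega)]
        · rw [if_neg h']; linarith
  refine (h N).trans ?_
  split_ifs
  · have : (0 : ℝ) < 4 / 3 * (4⁻¹ : ℝ) ^ N := by positivity
    linarith
  · linarith

/-- The admissible levels are all those from the first `k₀` with `2⁻ᵏ⁰ ≤ |t|` on, and a geometric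
sum is comparable to its first term. -/
lemma sum_level_le (N : ℕ) (t : ℝ) :
    ∑ k ∈ Finset.range N, (if (2⁻¹ : ℝ) ^ k ≤ |t| then (4⁻¹ : ℝ) ^ k else 0) ≤ 4 / 3 * t ^ 2 := by
  classical
  by_cases h : ∃ k : ℕ, (2⁻¹ : ℝ) ^ k ≤ |t|
  · have hk := Nat.find_spec h
    have hmin : ∀ m, (2⁻¹ : ℝ) ^ m ≤ |t| → Nat.find h ≤ m := fun m hm => Nat.find_min' h hm
    generalize Nat.find h = k₀ at hk hmin
    calc _ ≤ ∑ k ∈ Finset.range N, (if k₀ ≤ k then (4⁻¹ : ℝ) ^ k else 0) := by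
          refine Finset.sum_le_sum fun k _ => ?_
          by_cases hk' : (2⁻¹ : ℝ) ^ k ≤ |t|
          · rw [if_pos hk', if_pos (hmin k hk')]
          · rw [if_neg hk']; split_ifs <;> positivity
      _ ≤ 4 / 3 * (4⁻¹ : ℝ) ^ k₀ := sum_four_pow_inv_le N k₀
      _ ≤ 4 / 3 * t ^ 2 := by
          rw [← inv_two_pow_sq, ← sq_abs t]
          gcongr
  · push Not at h
    rw [Finset.sum_eq_zero]
    · positivity
    · intro k _
      rw [if_neg (not_le.2 (h k))]

/-- Exchanging `i j` with `a` is an involution on pairs. This lets one sum along fibers without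
splitting the index set into a product. -/
lemma sum_sum_update {d n : ℕ} (j : Fin d) (G : (Fin d → Fin n) → ℝ) :
    ∑ i : Fin d → Fin n, ∑ a, G (Function.update i j a) = n * ∑ i, G i := by
  let e : (Fin d → Fin n) × Fin n ≃ (Fin d → Fin n) × Fin n :=
    Function.Involutive.toPerm (fun p => (Function.update p.1 j p.2, p.1 j)) (by
      rintro ⟨i, a⟩; simp)
  rw [← Fintype.sum_prod_type', Fintype.sum_equiv e (fun p => G (Function.update p.1 j p.2))
    (fun p => G p.1) (fun p => rfl), Fintype.sum_prod_type]
  simp [Finset.mul_sum]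

/-- The product does not involve the index of mode `j`. Summing over that index first leaves a
fiber, at most `R ^ 2`; each of the other `d - 1` modes then contributes a factor of at most five.
-/
lemma sum_sq_mul_prod_erase_le {d n : ℕ} (T : Tensor d n) (R : ℝ)
    (hR : ∀ j i, ∑ a : Fin n, (T (Function.update i j a)) ^ 2 ≤ R ^ 2)
    (c : Fin d × Fin n → ℝ) (hc : ∀ j, ∑ a, c (j, a) ^ 2 ≤ 5) (j : Fin d) :
    ∑ i : Fin d → Fin n, (T i) ^ 2 * ∏ m ∈ Finset.univ.erase j, c (m, i m) ^ 2 ≤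
      5 ^ (d - 1) * R ^ 2 := by
  classical
  rcases Nat.eq_zero_or_pos n with rfl | hn
  · have : IsEmpty (Fin d → Fin 0) := ⟨fun f => (f j).elim0⟩
    rw [Finset.univ_eq_empty, Finset.sum_empty]; positivity
  have hn' : (0 : ℝ) < n := by exact_mod_cast hn
  refine le_of_mul_le_mul_left ?_ hn'
  rw [← sum_sum_update j]
  have h1 : ∀ i : Fin d → Fin n, ∑ a, (T (Function.update i j a)) ^ 2 *
      ∏ m ∈ Finset.univ.erase j, c (m, Function.update i j a m) ^ 2 ≤
      R ^ 2 * ∏ m, (if m = j then 1 else c (m, i m) ^ 2) := by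
    intro i
    have h2 : ∀ a, ∏ m ∈ Finset.univ.erase j, c (m, Function.update i j a m) ^ 2 =
        ∏ m, (if m = j then 1 else c (m, i m) ^ 2) := by
      intro a
      rw [← Finset.mul_prod_erase _ _ (Finset.mem_univ j), if_pos rfl, one_mul]
      refine Finset.prod_congr rfl fun m hm => ?_
      have := (Finset.mem_erase.1 hm).1
      rw [if_neg this, Function.update_of_ne this]
    simp only [h2, ← Finset.sum_mul]
    refine mul_le_mul_of_nonneg_right (hR j i) (Finset.prod_nonneg fun m _ => ?_)
    split_ifs <;> positivity
  refine (Finset.sum_le_sum fun i _ => h1 i).trans ?_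
  rw [← Finset.mul_sum]
  have h3 : ∑ i : Fin d → Fin n, ∏ m, (if m = j then 1 else c (m, i m) ^ 2) =
      ∏ m, ∑ a, (if m = j then 1 else c (m, a) ^ 2) := by
    rw [Finset.prod_univ_sum, Fintype.piFinset_univ]
  have h4 : ∏ m, ∑ a : Fin n, (if m = j then 1 else c (m, a) ^ 2) ≤ n * 5 ^ (d - 1) := by
    rw [← Finset.mul_prod_erase _ _ (Finset.mem_univ j)]
    have h5 : ∏ m ∈ Finset.univ.erase j, ∑ a : Fin n, (if m = j then 1 else c (m, a) ^ 2) ≤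
        ∏ m ∈ Finset.univ.erase j, (5 : ℝ) := by
      refine Finset.prod_le_prod (fun m _ => Finset.sum_nonneg fun a _ => ?_) fun m hm => ?_
      · split_ifs <;> positivity
      · simp only [if_neg (Finset.mem_erase.1 hm).1]; exact hc m
    rw [Finset.prod_const, Finset.card_erase_of_mem (Finset.mem_univ j), Finset.card_univ,
      Fintype.card_fin] at h5
    simpa using mul_le_mul_of_nonneg_left h5 hn'.le
  rw [h3]
  nlinarith [mul_le_mul_of_nonneg_left h4 (sq_nonneg R)]

/-- The part of a dyadic array that belongs to the level `k` and the mode `j`. -/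
noncomputable def piece {d n : ℕ} (j : Fin d) (k : ℕ) (c : Fin d × Fin n → ℝ) :
    Fin d × Fin n → ℝ :=
  fun p => pieceFactor j k p.1 (c p)

lemma form_eq_sum_pieces {d n : ℕ} (hd : 1 ≤ d) (S : Tensor d n) (c : Fin d × Fin n → ℝ)
    (hc : ∀ p, c p ∈ dyadics n) :
    form S c = ∑ j, ∑ k ∈ Finset.range (n + 1), form S (piece j k c) := by
  unfold form piece
  simp only [prod_eq_sum_pieces hd (fun m => c (m, _)) (fun m => hc _), Finset.mul_sum]
  rw [Finset.sum_comm]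
  refine Finset.sum_congr rfl fun j _ => ?_
  rw [Finset.sum_comm]

/-- The weight `4 ^ k` cancels the square of the `j`-th factor, and for each entry only one level
survives. Hence the sum over `k` simply erases mode `j` from the product. -/
lemma sum_formVar_pieces_le {d n : ℕ} (T : Tensor d n) (R : ℝ)
    (hR : ∀ j i, ∑ a : Fin n, (T (Function.update i j a)) ^ 2 ≤ R ^ 2)
    (c : Fin d × Fin n → ℝ) (hc : ∀ j, ∑ a, c (j, a) ^ 2 ≤ 5) :
    ∑ j, ∑ k ∈ Finset.range (n + 1), 4 ^ k * formVar T (piece j k c) ≤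
      d * (5 ^ (d - 1) * R ^ 2) := by
  classical
  have h : ∀ j, ∑ k ∈ Finset.range (n + 1), 4 ^ k * formVar T (piece j k c) ≤
      5 ^ (d - 1) * R ^ 2 := by
    intro j
    refine le_trans ?_ (sum_sq_mul_prod_erase_le T R hR c hc j)
    simp only [formVar, Finset.mul_sum]
    rw [Finset.sum_comm]
    refine Finset.sum_le_sum fun i _ => ?_
    have h1 : ∀ k, (4 : ℝ) ^ k * (T i * ∏ m, piece j k c (m, i m)) ^ 2 ≤
        ((T i) ^ 2 * ∏ m ∈ Finset.univ.erase j, c (m, i m) ^ 2) *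
          (4 ^ k * pieceFactor j k j (c (j, i j)) ^ 2) := by
      intro k
      rw [mul_pow, ← Finset.prod_pow, ← Finset.mul_prod_erase _ _ (Finset.mem_univ j)]
      have h2 : ∏ m ∈ Finset.univ.erase j, piece j k c (m, i m) ^ 2 ≤
          ∏ m ∈ Finset.univ.erase j, c (m, i m) ^ 2 :=
        Finset.prod_le_prod (fun m _ => sq_nonneg _) fun m _ => pieceFactor_sq_le _ _ _ _
      have h3 : (0 : ℝ) ≤ 4 ^ k * (T i) ^ 2 * pieceFactor j k j (c (j, i j)) ^ 2 := by positivity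
      have h4 := mul_le_mul_of_nonneg_left h2 h3
      have h5 : piece j k c (j, i j) = pieceFactor j k j (c (j, i j)) := rfl
      rw [h5]
      nlinarith [h4]
    refine (Finset.sum_le_sum fun k _ => h1 k).trans ?_
    rw [← Finset.mul_sum]
    refine mul_le_of_le_one_right ?_ (sum_four_pow_mul_pieceFactor_sq_le j _ _)
    exact mul_nonneg (sq_nonneg _) (Finset.prod_nonneg fun m _ => sq_nonneg _)
  refine (Finset.sum_le_sum fun j _ => h j).trans ?_
  simp

/-- An entry `t` is nonzero only in pieces with `2⁻ᵏ ≤ |t|`, so its weighted count is at most `4 / 3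
* t ^ 2`; the squares add up to at most `5 * d`. -/
lemma sum_suppSize_pieces_le {d n : ℕ} (c : Fin d × Fin n → ℝ)
    (hc : ∀ j, ∑ a, c (j, a) ^ 2 ≤ 5) (l q : ℝ) (hl : 0 ≤ l) (hq : 0 ≤ q) :
    ∑ j : Fin d, ∑ k ∈ Finset.range (n + 1), (4⁻¹ : ℝ) ^ k * (suppSize (piece j k c) * l + q) ≤
      d * (4 / 3 * (5 * d * l + q)) := by
  classical
  have h : ∀ j : Fin d, ∑ k ∈ Finset.range (n + 1),
      (4⁻¹ : ℝ) ^ k * (suppSize (piece j k c) * l + q) ≤ 4 / 3 * (5 * d * l + q) := by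
    intro j
    have h1 : ∑ k ∈ Finset.range (n + 1), (4⁻¹ : ℝ) ^ k * suppSize (piece j k c) ≤
        4 / 3 * (5 * d) := by
      simp only [suppSize, Finset.mul_sum]
      rw [Finset.sum_comm]
      have h2 : ∀ p, ∑ k ∈ Finset.range (n + 1),
          (4⁻¹ : ℝ) ^ k * (if piece j k c p = 0 then 0 else 1) ≤ 4 / 3 * c p ^ 2 := by
        intro p
        refine le_trans (Finset.sum_le_sum fun k _ => ?_) (sum_level_le (n + 1) (c p))
        by_cases h : (2⁻¹ : ℝ) ^ k ≤ |c p|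
        · rw [if_pos h]
          have : (0 : ℝ) ≤ (4⁻¹ : ℝ) ^ k := by positivity
          split_ifs <;> linarith
        · have : piece j k c p = 0 := by
            rw [piece, pieceFactor, if_neg]; exact fun h' => h h'.2.2
          rw [if_neg h, if_pos this, mul_zero]
      refine (Finset.sum_le_sum fun p _ => h2 p).trans ?_
      rw [← Finset.mul_sum, Fintype.sum_prod_type]
      refine mul_le_mul_of_nonneg_left ?_ (by norm_num)
      refine (Finset.sum_le_sum fun m _ => hc m).trans ?_
      simp [mul_comm]
    have h3 : ∑ k ∈ Finset.range (n + 1), (4⁻¹ : ℝ) ^ k ≤ 4 / 3 := by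
      simpa using sum_four_pow_inv_le (n + 1) 0
    calc _ = (∑ k ∈ Finset.range (n + 1), (4⁻¹ : ℝ) ^ k * suppSize (piece j k c)) * l +
          (∑ k ∈ Finset.range (n + 1), (4⁻¹ : ℝ) ^ k) * q := by
          rw [Finset.sum_mul, Finset.sum_mul, ← Finset.sum_add_distrib]
          exact Finset.sum_congr rfl fun k _ => by ring
      _ ≤ 4 / 3 * (5 * d) * l + 4 / 3 * q := by gcongr
      _ = _ := by ring
  refine (Finset.sum_le_sum fun j _ => h j).trans ?_
  simp

lemma suppSize_nonneg {d n : ℕ} (y : Fin d × Fin n → ℝ) : 0 ≤ suppSize y :=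
  Finset.sum_nonneg fun p _ => by split_ifs <;> norm_num

lemma formVar_nonneg {d n : ℕ} (T : Tensor d n) (y : Fin d × Fin n → ℝ) : 0 ≤ formVar T y :=
  Finset.sum_nonneg fun _ _ => sq_nonneg _

/-- A bound for all dyadic arrays in terms of variance and size of the support yields a bound
without a loss in the number of levels. -/
lemma abs_form_le_of_dyadic {d n : ℕ} (hd : 1 ≤ d) (S T : Tensor d n) (R : ℝ) (hR0 : 0 ≤ R)
    (hR : ∀ j i, ∑ a : Fin n, (T (Function.update i j a)) ^ 2 ≤ R ^ 2)
    (H l q : ℝ) (hH : 0 ≤ H) (hl : 0 ≤ l) (hq : 0 ≤ q)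
    (hS : ∀ y : Fin d × Fin n → ℝ, (∀ p, y p ∈ dyadics n) →
      |form S y| ≤ H * Real.sqrt (formVar T y * (suppSize y * l + q)))
    (c : Fin d × Fin n → ℝ) (hc : ∀ p, c p ∈ dyadics n) (hc5 : ∀ j, ∑ a, c (j, a) ^ 2 ≤ 5) :
    |form S c| ≤ H * (R * d * Real.sqrt (4 / 3 * 5 ^ (d - 1) * (5 * d * l + q))) := by
  classical
  rw [form_eq_sum_pieces hd S c hc, ← Finset.sum_product']
  set U := (Finset.univ : Finset (Fin d)) ×ˢ Finset.range (n + 1)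
  have h1 : |∑ x ∈ U, form S (piece x.1 x.2 c)| ≤ H * ∑ x ∈ U,
      Real.sqrt (4 ^ x.2 * formVar T (piece x.1 x.2 c)) *
      Real.sqrt ((4⁻¹ : ℝ) ^ x.2 * (suppSize (piece x.1 x.2 c) * l + q)) := by
    refine (Finset.abs_sum_le_sum_abs _ _).trans ?_
    rw [Finset.mul_sum]
    refine Finset.sum_le_sum fun x _ => ?_
    refine (hS (piece x.1 x.2 c) fun p => pieceFactor_mem_dyadics _ _ _ (hc p)).trans (le_of_eq ?_)
    rw [← Real.sqrt_mul (mul_nonneg (by positivity) (formVar_nonneg _ _))]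
    congr 2
    -- The weights are inserted here to prepare Cauchy–Schwarz.
    have : (4 : ℝ) ^ x.2 * (4⁻¹ : ℝ) ^ x.2 = 1 := by rw [← mul_pow]; norm_num
    linear_combination (-(formVar T (piece x.1 x.2 c)) *
      (suppSize (piece x.1 x.2 c) * l + q)) * this
  refine h1.trans (mul_le_mul_of_nonneg_left ?_ hH)
  refine (Real.sum_sqrt_mul_sqrt_le U (fun x => mul_nonneg (by positivity) (formVar_nonneg _ _))
    (fun x => mul_nonneg (by positivity)
      (add_nonneg (mul_nonneg (suppSize_nonneg _) hl) hq))).trans ?_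
  have h2 := sum_formVar_pieces_le T R hR c hc5
  have h3 := sum_suppSize_pieces_le c hc5 l q hl hq
  rw [← Finset.sum_product'] at h2 h3
  refine (mul_le_mul (Real.sqrt_le_sqrt h2) (Real.sqrt_le_sqrt h3) (Real.sqrt_nonneg _)
    (Real.sqrt_nonneg _)).trans (le_of_eq ?_)
  rw [← Real.sqrt_mul (by positivity)]
  have : (d : ℝ) * (5 ^ (d - 1) * R ^ 2) * (d * (4 / 3 * (5 * d * l + q))) =
      (R * d) ^ 2 * (4 / 3 * 5 ^ (d - 1) * (5 * d * l + q)) := by ring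
  rw [this, Real.sqrt_mul (by positivity), Real.sqrt_sq (by positivity)]

/-! ### Rademacher sums: exponential moments and the union bound -/

/-- The sign of a Boolean. -/
def sgn (b : Bool) : ℝ := if b then 1 else -1

/-- The tensor with the signs of its entries multiplied by given signs. -/
def signed {d n : ℕ} (e : (Fin d → Fin n) → Bool) (T : Tensor d n) : Tensor d n :=
  fun i => sgn (e i) * T i

/-- The sub-Gaussian bound for Rademacher sums. -/
lemma sum_exp_sgn_le {ι : Type*} [Fintype ι] [DecidableEq ι] (a : ι → ℝ) :
    ∑ e : ι → Bool, Real.exp (∑ i, sgn (e i) * a i) ≤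
      2 ^ Fintype.card ι * Real.exp ((∑ i, a i ^ 2) / 2) := by
  have h1 : ∑ e : ι → Bool, Real.exp (∑ i, sgn (e i) * a i) =
      ∏ i, ∑ b : Bool, Real.exp (sgn b * a i) := by
    rw [Finset.prod_univ_sum, Fintype.piFinset_univ]
    simp only [Real.exp_sum]
  have h2 : ∀ i, ∑ b : Bool, Real.exp (sgn b * a i) ≤ 2 * Real.exp (a i ^ 2 / 2) := by
    intro i
    have := Real.cosh_le_exp_half_sq (a i)
    rw [Real.cosh_eq] at this
    simp only [Fintype.sum_bool, sgn, if_true, one_mul, Bool.false_eq_true, if_false, neg_mul]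
    linarith
  rw [h1]
  refine (Finset.prod_le_prod (fun i _ => Finset.sum_nonneg fun b _ => (Real.exp_pos _).le)
    fun i _ => h2 i).trans (le_of_eq ?_)
  rw [Finset.prod_mul_distrib, ← Real.exp_sum, Finset.sum_div]
  simp

lemma form_signed {d n : ℕ} (e : (Fin d → Fin n) → Bool) (T : Tensor d n)
    (y : Fin d × Fin n → ℝ) :
    form (signed e T) y = ∑ i, sgn (e i) * (T i * ∏ k, y (k, i k)) := by
  simp only [form, signed, mul_assoc]

/-- The scale at which the exponential moment of `form (signed e T) y` is taken. -/
noncomputable def scale {d n : ℕ} (T : Tensor d n) (l q : ℝ) (y : Fin d × Fin n → ℝ) : ℝ :=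
  Real.sqrt ((suppSize y * l + q) / formVar T y)

/-- The weighted sum over all dyadic arrays of normalized exponential moments. -/
noncomputable def partitionSum {d n : ℕ} (T : Tensor d n) (l q : ℝ)
    (e : (Fin d → Fin n) → Bool) : ℝ :=
  ∑ y ∈ Fintype.piFinset (fun _ : Fin d × Fin n => dyadics n),
    Real.exp (-(suppSize y * l)) *
      (Real.exp (scale T l q y * form (signed e T) y - scale T l q y ^ 2 * formVar T y / 2) +
        Real.exp (-scale T l q y * form (signed e T) y - scale T l q y ^ 2 * formVar T y / 2))

lemma sum_exp_form_signed_le {d n : ℕ} (T : Tensor d n) (y : Fin d × Fin n → ℝ) (t : ℝ) :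
    ∑ e : (Fin d → Fin n) → Bool, Real.exp (t * form (signed e T) y - t ^ 2 * formVar T y / 2) ≤
      2 ^ Fintype.card (Fin d → Fin n) := by
  have h := sum_exp_sgn_le (fun i : Fin d → Fin n => t * (T i * ∏ k, y (k, i k)))
  have h1 : ∑ i : Fin d → Fin n, (t * (T i * ∏ k, y (k, i k))) ^ 2 = t ^ 2 * formVar T y := by
    rw [formVar, Finset.mul_sum]
    exact Finset.sum_congr rfl fun i _ => by ring
  rw [h1] at h
  have h2 : ∀ e : (Fin d → Fin n) → Bool,
      ∑ i, sgn (e i) * (t * (T i * ∏ k, y (k, i k))) = t * form (signed e T) y := by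
    intro e
    rw [form_signed, Finset.mul_sum]
    exact Finset.sum_congr rfl fun i _ => by ring
  simp only [h2] at h
  simp only [Real.exp_sub, ← Finset.sum_div]
  rwa [div_le_iff₀ (Real.exp_pos _)]

lemma card_dyadics_erase_zero_le (n : ℕ) : (((dyadics n).erase 0).card : ℝ) ≤ 2 * (n + 1) := by
  classical
  have h : ((dyadics n).erase 0).card ≤ 2 * (n + 1) := by
    have h1 : (dyadics n).erase 0 ⊆ (Finset.range (n + 1)).image (fun k => (2⁻¹ : ℝ) ^ k) ∪
        (Finset.range (n + 1)).image (fun k => -(2⁻¹ : ℝ) ^ k) :=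
      Finset.erase_insert_subset _ _
    refine (Finset.card_le_card h1).trans ((Finset.card_union_le _ _).trans ?_)
    have h2 := Finset.card_image_le (s := Finset.range (n + 1)) (f := fun k => (2⁻¹ : ℝ) ^ k)
    have h3 := Finset.card_image_le (s := Finset.range (n + 1)) (f := fun k => -(2⁻¹ : ℝ) ^ k)
    rw [Finset.card_range] at h2 h3
    omega
  exact_mod_cast h

/-- The weight is a product over the `d * n` positions. Each position sums to at most `1 + 2(n+1) /
(2dn(n+1)) = 1 + 1/(dn) ≤ exp (1/(dn))`, which dictates the logarithm. -/
lemma sum_exp_neg_suppSize_le {d n : ℕ} (hd : 1 ≤ d) (hn : 1 ≤ n) :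
    ∑ y ∈ Fintype.piFinset (fun _ : Fin d × Fin n => dyadics n),
      Real.exp (-(suppSize y * Real.log (2 * d * n * (n + 1)))) ≤ Real.exp 1 := by
  classical
  have hd' : (0 : ℝ) < d := by exact_mod_cast hd
  have hn' : (0 : ℝ) < n := by exact_mod_cast hn
  have hpos : (0 : ℝ) < 2 * d * n * (n + 1) := by positivity
  have h1 : ∀ y : Fin d × Fin n → ℝ,
      Real.exp (-(suppSize y * Real.log (2 * d * n * (n + 1)))) =
      ∏ p, (if y p = 0 then 1 else (2 * d * n * (n + 1) : ℝ)⁻¹) := by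
    intro y
    rw [suppSize, Finset.sum_mul, ← Finset.sum_neg_distrib, Real.exp_sum]
    refine Finset.prod_congr rfl fun p _ => ?_
    split_ifs
    · simp
    · rw [one_mul, Real.exp_neg, Real.exp_log hpos]
  simp only [h1]
  rw [← Finset.prod_univ_sum (fun _ : Fin d × Fin n => dyadics n)
    (fun _ v => if v = 0 then 1 else (2 * d * n * (n + 1) : ℝ)⁻¹)]
  have h2 : ∑ v ∈ dyadics n, (if v = 0 then 1 else (2 * d * n * (n + 1) : ℝ)⁻¹) ≤
      Real.exp (1 / (d * n)) := by
    rw [← Finset.add_sum_erase _ _ (zero_mem_dyadics n), if_pos rfl]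
    have h3 : ∑ v ∈ (dyadics n).erase 0, (if v = 0 then 1 else (2 * d * n * (n + 1) : ℝ)⁻¹) =
        ((dyadics n).erase 0).card * (2 * d * n * (n + 1) : ℝ)⁻¹ := by
      rw [← nsmul_eq_mul, ← Finset.sum_const]
      exact Finset.sum_congr rfl fun v hv => if_neg (Finset.mem_erase.1 hv).1
    have h4 : ((dyadics n).erase 0).card * (2 * d * n * (n + 1) : ℝ)⁻¹ ≤ 1 / (d * n) := by
      refine (mul_le_mul_of_nonneg_right (card_dyadics_erase_zero_le n)
        (inv_nonneg.2 hpos.le)).trans (le_of_eq ?_)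
      field_simp
    rw [h3]
    linarith [Real.add_one_le_exp (1 / (d * n : ℝ))]
  refine (Finset.prod_le_prod (fun p _ => Finset.sum_nonneg fun v _ => ?_)
    fun p _ => h2).trans (le_of_eq ?_)
  · split_ifs <;> positivity
  · rw [Finset.prod_const, ← Real.exp_nat_mul]
    congr 1
    simp only [Finset.card_univ, Fintype.card_prod, Fintype.card_fin, Nat.cast_mul]
    field_simp

lemma sum_partitionSum_le {d n : ℕ} (hd : 1 ≤ d) (hn : 1 ≤ n) (T : Tensor d n) (q : ℝ) :
    ∑ e, partitionSum T (Real.log (2 * d * n * (n + 1))) q e ≤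
      2 ^ Fintype.card (Fin d → Fin n) * 6 := by
  unfold partitionSum
  rw [Finset.sum_comm]
  have h1 : ∀ y : Fin d × Fin n → ℝ, ∑ e : (Fin d → Fin n) → Bool,
      Real.exp (-(suppSize y * Real.log (2 * d * n * (n + 1)))) *
      (Real.exp (scale T (Real.log (2 * d * n * (n + 1))) q y * form (signed e T) y -
          scale T (Real.log (2 * d * n * (n + 1))) q y ^ 2 * formVar T y / 2) +
        Real.exp (-scale T (Real.log (2 * d * n * (n + 1))) q y * form (signed e T) y -
          scale T (Real.log (2 * d * n * (n + 1))) q y ^ 2 * formVar T y / 2)) ≤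
      Real.exp (-(suppSize y * Real.log (2 * d * n * (n + 1)))) *
        (2 * 2 ^ Fintype.card (Fin d → Fin n)) := by
    intro y
    rw [← Finset.mul_sum, Finset.sum_add_distrib]
    refine mul_le_mul_of_nonneg_left ?_ (Real.exp_pos _).le
    have e1 := sum_exp_form_signed_le T y (scale T (Real.log (2 * d * n * (n + 1))) q y)
    have e2 := sum_exp_form_signed_le T y (-scale T (Real.log (2 * d * n * (n + 1))) q y)
    rw [neg_sq] at e2
    linarith
  refine (Finset.sum_le_sum fun y _ => h1 y).trans ?_
  rw [← Finset.sum_mul]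
  have h2 := sum_exp_neg_suppSize_le hd hn
  -- The two signs in each summand of `partitionSum` give `2 * e ≤ 6`.
  have h3 : Real.exp 1 ≤ 3 := by linarith [Real.exp_one_lt_d9]
  have h4 : (0 : ℝ) < 2 ^ Fintype.card (Fin d → Fin n) := by positivity
  nlinarith [mul_le_mul_of_nonneg_right (h2.trans h3) h4.le]

lemma term_le_partitionSum {d n : ℕ} (T : Tensor d n) (l q : ℝ) (e : (Fin d → Fin n) → Bool)
    (y : Fin d × Fin n → ℝ) (hy : ∀ p, y p ∈ dyadics n) :
    Real.exp (scale T l q y * |form (signed e T) y| - scale T l q y ^ 2 * formVar T y / 2 -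
      suppSize y * l) ≤ partitionSum T l q e := by
  have h1 : Real.exp (-(suppSize y * l)) *
      (Real.exp (scale T l q y * form (signed e T) y - scale T l q y ^ 2 * formVar T y / 2) +
        Real.exp (-scale T l q y * form (signed e T) y - scale T l q y ^ 2 * formVar T y / 2)) ≤
      partitionSum T l q e :=
    Finset.single_le_sum (f := fun y : Fin d × Fin n → ℝ => Real.exp (-(suppSize y * l)) *
      (Real.exp (scale T l q y * form (signed e T) y - scale T l q y ^ 2 * formVar T y / 2) +
        Real.exp (-scale T l q y * form (signed e T) y - scale T l q y ^ 2 * formVar T y / 2)))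
      (fun y _ => by positivity) (Fintype.mem_piFinset.2 hy)
  refine le_trans ?_ h1
  rw [sub_eq_neg_add _ (suppSize y * l), Real.exp_add]
  refine mul_le_mul_of_nonneg_left ?_ (Real.exp_pos _).le
  rcases abs_choice (form (signed e T) y) with h | h <;> rw [h]
  · exact le_add_of_nonneg_right (Real.exp_pos _).le
  · rw [mul_neg, ← neg_mul]
    exact le_add_of_nonneg_left (Real.exp_pos _).le

/-- The zero array alone contributes enough; its form vanishes only because `d ≠ 0` excludes the
empty product. -/
lemma one_le_partitionSum {d n : ℕ} (hd : 1 ≤ d) (T : Tensor d n) (l q : ℝ)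
    (e : (Fin d → Fin n) → Bool) : 1 ≤ partitionSum T l q e := by
  have h := term_le_partitionSum T l q e (fun _ => 0) fun _ => zero_mem_dyadics n
  have hd' : d ≠ 0 := by omega
  simpa [form, formVar, suppSize, hd'] using h

/-- Take logarithms in `term_le_partitionSum`. With `N = suppSize y * l` the scale `σ` satisfies `σ²
* formVar T y = N + q`, so `σ * |form|` is at most `(N + q) / 2 + N + log Z`, where `Z` is the
partition sum. -/
lemma abs_form_signed_le {d n : ℕ} (hd : 1 ≤ d) (T : Tensor d n) {l q : ℝ} (hl : 0 ≤ l)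
    (hq : 0 < q) (e : (Fin d → Fin n) → Bool) (y : Fin d × Fin n → ℝ)
    (hy : ∀ p, y p ∈ dyadics n) :
    |form (signed e T) y| ≤ (3 / 2 + Real.log (partitionSum T l q e) / q) *
      Real.sqrt (formVar T y * (suppSize y * l + q)) := by
  have hZ := one_le_partitionSum hd T l q e
  have hL : 0 ≤ Real.log (partitionSum T l q e) := Real.log_nonneg hZ
  have hterm := term_le_partitionSum T l q e y hy
  rw [← Real.le_log_iff_exp_le (by linarith)] at hterm
  set L := Real.log (partitionSum T l q e)
  have hN : 0 ≤ suppSize y * l := mul_nonneg (suppSize_nonneg y) hl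
  set N := suppSize y * l
  -- Zero variance makes the scale degenerate (division by zero), but then every monomial vanishes.
  rcases (formVar_nonneg T y).eq_or_lt with hv | hv
  · have h0 : ∀ i, T i * ∏ k, y (k, i k) = 0 := by
      intro i
      have := (Finset.sum_eq_zero_iff_of_nonneg
        (fun (i : Fin d → Fin n) _ => sq_nonneg (T i * ∏ k, y (k, i k)))).1 hv.symm i
        (Finset.mem_univ i)
      exact pow_eq_zero_iff (two_ne_zero) |>.1 this
    rw [form_signed]
    simp only [h0, mul_zero, Finset.sum_const_zero, abs_zero]
    positivity
  · set v := formVar T y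
    have hs : scale T l q y ^ 2 * v = N + q := by
      rw [scale, Real.sq_sqrt (by positivity)]
      exact div_mul_cancel₀ _ hv.ne'
    have hspos : 0 < scale T l q y := Real.sqrt_pos.2 (by positivity)
    have hsq : Real.sqrt (v * (N + q)) = scale T l q y * v := by
      rw [← hs, show v * (scale T l q y ^ 2 * v) = (scale T l q y * v) ^ 2 by ring]
      exact Real.sqrt_sq (by positivity)
    rw [hsq]
    refine le_of_mul_le_mul_left ?_ hspos
    have h1 : L ≤ L / q * (N + q) := by
      have : L = L / q * q := by field_simp
      have h2 : 0 ≤ L / q * N := by positivity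
      nlinarith
    have h3 : scale T l q y * ((3 / 2 + L / q) * (scale T l q y * v)) =
        (3 / 2 + L / q) * (N + q) := by rw [← hs]; ring
    rw [h3]
    rw [hs] at hterm
    nlinarith

lemma specNorm_nonneg {d n : ℕ} (T : Tensor d n) : 0 ≤ specNorm T := by
  refine Real.sSup_nonneg ?_
  rintro _ ⟨x, _, rfl⟩
  exact abs_nonneg _

lemma specNorm_le {d n : ℕ} (T : Tensor d n) {C : ℝ} (hC : 0 ≤ C)
    (h : ∀ x : Fin d → EuclideanSpace ℝ (Fin n), (∀ k, ‖x k‖ = 1) → |contract T x| ≤ C) :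
    specNorm T ≤ C := by
  refine Real.sSup_le ?_ hC
  rintro _ ⟨x, hx, rfl⟩
  exact h x hx

/-- The bound for the `q`-th moment of the spectral norm of a tensor with random signs. -/
lemma sum_specNorm_signed_rpow_le {d n : ℕ} (hd : 1 ≤ d) (hn : 1 ≤ n) (T : Tensor d n) (R : ℝ)
    (hR0 : 0 ≤ R) (hR : ∀ j i, ∑ a : Fin n, (T (Function.update i j a)) ^ 2 ≤ R ^ 2)
    {q : ℝ} (hq : 1 ≤ q) :
    ∑ e, specNorm (signed e T) ^ q ≤ 2 ^ Fintype.card (Fin d → Fin n) *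
      (12 * d * Real.sqrt (4 / 3 * 5 ^ (d - 1) *
        (5 * d * Real.log (2 * d * n * (n + 1)) + q)) * R) ^ q := by
  have hd' : (1 : ℝ) ≤ d := by exact_mod_cast hd
  have hn' : (1 : ℝ) ≤ n := by exact_mod_cast hn
  have hl : 0 ≤ Real.log (2 * d * n * (n + 1)) := by
    refine Real.log_nonneg ?_
    have : (1 : ℝ) ≤ d * n := one_le_mul_of_one_le_of_one_le hd' hn'
    nlinarith
  have hsum := sum_partitionSum_le hd hn T q
  set l := Real.log (2 * d * n * (n + 1))
  set G := d * Real.sqrt (4 / 3 * 5 ^ (d - 1) * (5 * d * l + q))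
  have hq0 : 0 < q := by linarith
  have hG : 0 ≤ G := by positivity
  have h1 : ∀ e, specNorm (signed e T) ^ q ≤
      (R * G) ^ q * (Real.exp (q / 2) * partitionSum T l q e) := by
    intro e
    have hZ := one_le_partitionSum hd T l q e
    have hL : 0 ≤ Real.log (partitionSum T l q e) := Real.log_nonneg hZ
    have hH : 0 ≤ 3 / 2 + Real.log (partitionSum T l q e) / q := by positivity
    have h2 : specNorm (signed e T) ≤
        (3 / 2 + Real.log (partitionSum T l q e) / q) * (R * G) := by
      refine specNorm_le _ (by positivity) fun x hx => ?_
      obtain ⟨c, hc, hc5, hle⟩ := exists_dyadic_form_ge (signed e T) x hx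
      refine hle.trans ?_
      have := abs_form_le_of_dyadic hd (signed e T) T R hR0 hR _ l q hH hl hq0.le
        (fun y hy => abs_form_signed_le hd T hl hq0 e y hy) c hc hc5
      simpa only [G, mul_assoc] using this
    refine (Real.rpow_le_rpow (specNorm_nonneg _) h2 hq0.le).trans ?_
    rw [Real.mul_rpow hH (by positivity), mul_comm]
    refine mul_le_mul_of_nonneg_left ?_ (by positivity)
    -- By `1 + x ≤ exp x`, the `q`-th power of this factor is at most `exp (q / 2) * Z`, so only the
    -- mean of `Z` over the signs is needed.
    have h3 : 3 / 2 + Real.log (partitionSum T l q e) / q ≤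
        Real.exp (1 / 2 + Real.log (partitionSum T l q e) / q) := by
      linarith [Real.add_one_le_exp (1 / 2 + Real.log (partitionSum T l q e) / q)]
    refine (Real.rpow_le_rpow hH h3 hq0.le).trans (le_of_eq ?_)
    rw [← Real.exp_mul, add_mul, div_mul_cancel₀ _ hq0.ne', Real.exp_add,
      Real.exp_log (by linarith)]
    congr 2; ring
  refine (Finset.sum_le_sum fun e _ => h1 e).trans ?_
  rw [← Finset.mul_sum, ← Finset.mul_sum]
  have h4 : 12 * d * Real.sqrt (4 / 3 * 5 ^ (d - 1) * (5 * d * l + q)) * R = 12 * (R * G) := by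
    simp only [G]; ring
  have h5 : Real.exp (q / 2) * 6 ≤ 12 ^ q := by
    have e1 : Real.exp (q / 2) ≤ 2 ^ q := by
      rw [Real.rpow_def_of_pos (by norm_num)]
      refine Real.exp_le_exp.2 ?_
      nlinarith [Real.log_two_gt_d9]
    have e2 : (6 : ℝ) ≤ 6 ^ q := by
      simpa using Real.rpow_le_rpow_of_exponent_le (by norm_num : (1 : ℝ) ≤ 6) hq
    calc Real.exp (q / 2) * 6 ≤ 2 ^ q * 6 ^ q := by gcongr
      _ = 12 ^ q := by rw [← Real.mul_rpow (by norm_num) (by norm_num)]; norm_num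
  rw [h4, Real.mul_rpow (by norm_num : (0 : ℝ) ≤ 12) (mul_nonneg hR0 hG)]
  calc (R * G) ^ q * (Real.exp (q / 2) * ∑ e, partitionSum T l q e)
      ≤ (R * G) ^ q * (Real.exp (q / 2) * (2 ^ Fintype.card (Fin d → Fin n) * 6)) := by gcongr
    _ = 2 ^ Fintype.card (Fin d → Fin n) * ((Real.exp (q / 2) * 6) * (R * G) ^ q) := by ring
    _ ≤ 2 ^ Fintype.card (Fin d → Fin n) * (12 ^ q * (R * G) ^ q) := by gcongr

/-! ### The spectral norm: subadditivity, measurability, Jensen's inequality -/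

lemma contract_add {d n : ℕ} (S T : Tensor d n) (x : Fin d → EuclideanSpace ℝ (Fin n)) :
    contract (S + T) x = contract S x + contract T x := by
  simp only [contract, Pi.add_apply, add_mul, Finset.sum_add_distrib]

lemma contract_neg {d n : ℕ} (T : Tensor d n) (x : Fin d → EuclideanSpace ℝ (Fin n)) :
    contract (-T) x = -contract T x := by
  simp only [contract, Pi.neg_apply, neg_mul, Finset.sum_neg_distrib]

lemma abs_contract_le_sum {d n : ℕ} (T : Tensor d n) (x : Fin d → EuclideanSpace ℝ (Fin n))
    (hx : ∀ k, ‖x k‖ = 1) : |contract T x| ≤ ∑ i, |T i| := by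
  refine (Finset.abs_sum_le_sum_abs _ _).trans (Finset.sum_le_sum fun i _ => ?_)
  rw [abs_mul, Finset.abs_prod]
  refine mul_le_of_le_one_right (abs_nonneg _) (Finset.prod_le_one (fun k _ => abs_nonneg _) ?_)
  intro k _
  rw [← hx k]
  exact PiLp.norm_apply_le (x k) (i k)

lemma abs_contract_le_specNorm {d n : ℕ} (T : Tensor d n)
    (x : Fin d → EuclideanSpace ℝ (Fin n)) (hx : ∀ k, ‖x k‖ = 1) :
    |contract T x| ≤ specNorm T := by
  refine le_csSup ⟨∑ i, |T i|, ?_⟩ ⟨x, hx, rfl⟩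
  rintro _ ⟨y, hy, rfl⟩
  exact abs_contract_le_sum T y hy

lemma specNorm_le_sum {d n : ℕ} (T : Tensor d n) : specNorm T ≤ ∑ i, |T i| :=
  specNorm_le T (Finset.sum_nonneg fun _ _ => abs_nonneg _) (abs_contract_le_sum T)

lemma specNorm_add_le {d n : ℕ} (S T : Tensor d n) :
    specNorm (S + T) ≤ specNorm S + specNorm T := by
  refine specNorm_le _ (add_nonneg (specNorm_nonneg _) (specNorm_nonneg _)) fun x hx => ?_
  rw [contract_add]
  exact (abs_add_le _ _).trans
    (add_le_add (abs_contract_le_specNorm S x hx) (abs_contract_le_specNorm T x hx))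

lemma specNorm_neg {d n : ℕ} (T : Tensor d n) : specNorm (-T) = specNorm T := by
  unfold specNorm
  simp only [contract_neg, abs_neg]

/-- The norm is Lipschitz for the entrywise ℓ¹ distance. Continuity supplies the measurability that
a supremum over uncountably many vectors does not give directly. -/
lemma continuous_specNorm {d n : ℕ} : Continuous (specNorm : Tensor d n → ℝ) := by
  have h1 : ∀ S T : Tensor d n, specNorm S - specNorm T ≤ ∑ i, |S i - T i| := by
    intro S T
    have h := specNorm_add_le T (S - T)
    rw [add_sub_cancel] at h
    have h2 := specNorm_le_sum (S - T)
    simp only [Pi.sub_apply] at h2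
    linarith
  refine continuous_iff_continuousAt.2 fun T => tendsto_iff_dist_tendsto_zero.2 ?_
  refine squeeze_zero (g := fun S : Tensor d n => ∑ i, |S i - T i|) (fun _ => dist_nonneg)
    (fun S => ?_) ?_
  · rw [Real.dist_eq, abs_le]
    have h2 := h1 T S
    simp only [abs_sub_comm (T _)] at h2
    exact ⟨by linarith, h1 S T⟩
  · have h3 : Continuous (fun S : Tensor d n => ∑ i, |S i - T i|) := by fun_prop
    simpa using h3.tendsto T

lemma measurable_specNorm {d n : ℕ} : Measurable (specNorm : Tensor d n → ℝ) :=
  continuous_specNorm.measurable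

/-- Jensen's inequality for the spectral norm. -/
lemma specNorm_rpow_le_lintegral {d n : ℕ} (ν : Measure (Tensor d n)) [IsProbabilityMeasure ν]
    (hint : ∀ i, Integrable (fun y : Tensor d n => y i) ν) (hmean : ∀ i, ∫ y, y i ∂ν = 0)
    (x : Tensor d n) {q : ℝ} (hq : 1 ≤ q) :
    ENNReal.ofReal (specNorm x ^ q) ≤ ∫⁻ y, ENNReal.ofReal (specNorm (x + y) ^ q) ∂ν := by
  have hq0 : 0 < q := by linarith
  have hmeas : Measurable (fun y : Tensor d n => specNorm (x + y)) :=
    measurable_specNorm.comp (measurable_const_add x)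
  have hi : Integrable (fun y : Tensor d n => specNorm (x + y)) ν := by
    have h1 : Integrable (fun y : Tensor d n => ∑ i, |x i + y i|) ν :=
      integrable_finsetSum _ fun i _ => ((integrable_const (x i)).add (hint i)).abs
    refine h1.mono' hmeas.aestronglyMeasurable (Filter.Eventually.of_forall fun y => ?_)
    rw [Real.norm_of_nonneg (specNorm_nonneg _)]
    exact specNorm_le_sum _
  have h2 : specNorm x ≤ ∫ y, specNorm (x + y) ∂ν := by
    refine specNorm_le _ (integral_nonneg fun y => specNorm_nonneg _) fun v hv => ?_
    have hterm : ∀ i ∈ (Finset.univ : Finset (Fin d → Fin n)),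
        Integrable (fun y : Tensor d n => y i * ∏ k, v k (i k)) ν :=
      fun i _ => (hint i).mul_const _
    have hc0 : ∫ y, contract y v ∂ν = 0 := by
      unfold contract
      rw [integral_finsetSum _ hterm]
      refine Finset.sum_eq_zero fun i _ => ?_
      rw [integral_mul_const, hmean i, zero_mul]
    have hci : Integrable (fun y : Tensor d n => contract y v) ν :=
      integrable_finsetSum _ hterm
    have hcx : ∫ y, contract (x + y) v ∂ν = contract x v := by
      simp only [contract_add]
      rw [integral_add (integrable_const _) hci, hc0]
      simp
    -- For fixed unit vectors the contraction is linear, so the centered `y` can be added under the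
    -- integral before passing to the supremum.
    rw [← hcx]
    refine (abs_integral_le_integral_abs).trans ?_
    refine integral_mono_of_nonneg (Filter.Eventually.of_forall fun y => abs_nonneg _) hi
      (Filter.Eventually.of_forall fun y => abs_contract_le_specNorm _ v hv)
  have h3 : ENNReal.ofReal (specNorm x) ≤ ∫⁻ y, ENNReal.ofReal (specNorm (x + y)) ∂ν := by
    rw [← ofReal_integral_eq_lintegral_ofReal hi
      (Filter.Eventually.of_forall fun y => specNorm_nonneg _)]
    exact ENNReal.ofReal_le_ofReal h2
  have h4 := eLpNorm'_le_eLpNorm'_of_exponent_le (μ := ν) (zero_lt_one) hq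
    hmeas.aestronglyMeasurable
  simp only [eLpNorm', Real.enorm_of_nonneg (specNorm_nonneg _), ENNReal.rpow_one, div_one] at h4
  have h5 := ENNReal.rpow_le_rpow (h3.trans h4) hq0.le
  rw [← ENNReal.rpow_mul, one_div_mul_cancel hq0.ne', ENNReal.rpow_one] at h5
  simpa only [ENNReal.ofReal_rpow_of_nonneg (specNorm_nonneg _) hq0.le] using h5

/-! ### Deleting entries and changing signs -/

open Classical in
/-- The restriction of a tensor to a set of indices. -/
noncomputable def restrictTo {d n : ℕ} (s : Finset (Fin d → Fin n)) (T : Tensor d n) :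
    Tensor d n :=
  fun i => if i ∈ s then T i else 0

variable {d n : ℕ} {Ω : Type*} [MeasurableSpace Ω] {P : Measure Ω}

lemma measurable_restrictTo (s : Finset (Fin d → Fin n)) {B : Ω → Tensor d n}
    (hB : ∀ i, Measurable (fun ω => B ω i)) : Measurable (fun ω => restrictTo s (B ω)) := by
  refine measurable_pi_lambda _ fun i => ?_
  unfold restrictTo
  split_ifs
  exacts [hB i, measurable_const]

open Classical in
lemma indepFun_restrictTo [IsProbabilityMeasure P] (s t : Finset (Fin d → Fin n))
    (hst : Disjoint s t) {B : Ω → Tensor d n} (hB : ∀ i, Measurable (fun ω => B ω i))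
    (hind : iIndepFun (fun i ω => B ω i) P) :
    IndepFun (fun ω => restrictTo s (B ω)) (fun ω => restrictTo t (B ω)) P := by
  have h := hind.indepFun_finset s t hst hB
  have hm : ∀ u : Finset (Fin d → Fin n), Measurable
      (fun (b : u → ℝ) (i : Fin d → Fin n) => if h : i ∈ u then b ⟨i, h⟩ else 0) := by
    intro u
    refine measurable_pi_lambda _ fun i => ?_
    split_ifs with hi
    exacts [measurable_pi_apply _, measurable_const]
  have h2 := h.comp (hm s) (hm t)
  have e : ∀ u : Finset (Fin d → Fin n),
      (fun (b : u → ℝ) (i : Fin d → Fin n) => if h : i ∈ u then b ⟨i, h⟩ else 0) ∘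
        (fun ω (i : u) => B ω i) = fun ω => restrictTo u (B ω) := by
    intro u
    funext ω i
    simp only [Function.comp, restrictTo]
    split_ifs <;> rfl
  rwa [e s, e t] at h2

open Classical in
lemma restrictTo_add_restrictTo_compl (s : Finset (Fin d → Fin n)) (T : Tensor d n) :
    restrictTo s T + restrictTo sᶜ T = T := by
  funext i
  by_cases h : i ∈ s <;> simp [restrictTo, h]

/-- Deleting some of the entries of a tensor with independent centered entries does not
increase the moments of its spectral norm. -/
lemma lintegral_specNorm_restrictTo_le [IsProbabilityMeasure P] (s : Finset (Fin d → Fin n))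
    {B : Ω → Tensor d n} (hB : ∀ i, Measurable (fun ω => B ω i))
    (hind : iIndepFun (fun i ω => B ω i) P) (hint : ∀ i, Integrable (fun ω => B ω i) P)
    (hmean : ∀ i, ∫ ω, B ω i ∂P = 0) {q : ℝ} (hq : 1 ≤ q) :
    ∫⁻ ω, ENNReal.ofReal (specNorm (restrictTo s (B ω)) ^ q) ∂P ≤
      ∫⁻ ω, ENNReal.ofReal (specNorm (B ω) ^ q) ∂P := by
  classical
  have hX := measurable_restrictTo s hB
  have hY := measurable_restrictTo sᶜ hB
  have hXY := (indepFun_iff_map_prod_eq_prod_map_map hX.aemeasurable hY.aemeasurable).1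
    (indepFun_restrictTo s sᶜ disjoint_compl_right hB hind)
  have hf : Measurable (fun T : Tensor d n => ENNReal.ofReal (specNorm T ^ q)) :=
    (measurable_specNorm.pow_const q).ennreal_ofReal
  have hf2 : Measurable (fun p : Tensor d n × Tensor d n =>
      ENNReal.ofReal (specNorm (p.1 + p.2) ^ q)) :=
    hf.comp (measurable_fst.add measurable_snd)
  -- The entries inside and outside `s` are independent, so one may integrate over the outer ones
  -- with the inner ones frozen and apply Jensen there.
  have h1 : ∫⁻ ω, ENNReal.ofReal (specNorm (B ω) ^ q) ∂P =
      ∫⁻ x, ∫⁻ y, ENNReal.ofReal (specNorm (x + y) ^ q)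
        ∂(P.map fun ω => restrictTo sᶜ (B ω)) ∂(P.map fun ω => restrictTo s (B ω)) := by
    have : IsProbabilityMeasure (P.map fun ω => restrictTo sᶜ (B ω)) :=
      Measure.isProbabilityMeasure_map hY.aemeasurable
    rw [← lintegral_prod (fun p : Tensor d n × Tensor d n =>
      ENNReal.ofReal (specNorm (p.1 + p.2) ^ q)) hf2.aemeasurable, ← hXY,
      lintegral_map hf2 (hX.prodMk hY)]
    simp only [restrictTo_add_restrictTo_compl]
  rw [h1, ← lintegral_map hf hX]
  refine lintegral_mono fun x => ?_
  have : IsProbabilityMeasure (P.map fun ω => restrictTo sᶜ (B ω)) :=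
    Measure.isProbabilityMeasure_map hY.aemeasurable
  refine specNorm_rpow_le_lintegral _ (fun i => ?_) (fun i => ?_) x hq
  · rw [integrable_map_measure (measurable_pi_apply i).aestronglyMeasurable hY.aemeasurable]
    by_cases h : i ∈ sᶜ
    · simpa only [Function.comp_def, restrictTo, if_pos h] using hint i
    · simpa only [Function.comp_def, restrictTo, if_neg h] using integrable_const (0 : ℝ)
  · rw [integral_map hY.aemeasurable (measurable_pi_apply i).aestronglyMeasurable]
    by_cases h : i ∈ sᶜ
    · simpa only [restrictTo, if_pos h] using hmean i
    · simp only [restrictTo, if_neg h, integral_zero]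

/-- Changing the signs of the entries costs a factor two at most. -/
lemma lintegral_specNorm_le_signed [IsProbabilityMeasure P]
    {B : Ω → Tensor d n} (hB : ∀ i, Measurable (fun ω => B ω i))
    (hind : iIndepFun (fun i ω => B ω i) P) (hint : ∀ i, Integrable (fun ω => B ω i) P)
    (hmean : ∀ i, ∫ ω, B ω i ∂P = 0) {q : ℝ} (hq : 1 ≤ q) (e : (Fin d → Fin n) → Bool) :
    ∫⁻ ω, ENNReal.ofReal (specNorm (B ω) ^ q) ∂P ≤
      ENNReal.ofReal (2 ^ q) * ∫⁻ ω, ENNReal.ofReal (specNorm (signed e (B ω)) ^ q) ∂P := by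
  classical
  have hC : ∀ i, Measurable (fun ω => signed e (B ω) i) := fun i => (hB i).const_mul _
  have hCind : iIndepFun (fun i ω => signed e (B ω) i) P :=
    hind.comp (fun i t => sgn (e i) * t) fun i => measurable_const_mul _
  have hCint : ∀ i, Integrable (fun ω => signed e (B ω) i) P := fun i => (hint i).const_mul _
  have hCmean : ∀ i, ∫ ω, signed e (B ω) i ∂P = 0 := by
    intro i
    simp only [signed]
    rw [integral_const_mul, hmean i, mul_zero]
  set s : Finset (Fin d → Fin n) := Finset.univ.filter fun i => e i = true
  have h1 := lintegral_specNorm_restrictTo_le s hC hCind hCint hCmean hq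
  have h2 := lintegral_specNorm_restrictTo_le sᶜ hC hCind hCint hCmean hq
  have e1 : ∀ T : Tensor d n, restrictTo s T = restrictTo s (signed e T) := by
    intro T
    funext i
    by_cases h : e i = true <;> simp [restrictTo, signed, sgn, s, h]
  have e2 : ∀ T : Tensor d n, restrictTo sᶜ T = -restrictTo sᶜ (signed e T) := by
    intro T
    funext i
    by_cases h : e i = true <;> simp [restrictTo, signed, sgn, s, h]
  have hm1 : Measurable fun ω => ENNReal.ofReal (specNorm (restrictTo s (signed e (B ω))) ^ q) :=
    ((measurable_specNorm.comp (measurable_restrictTo s hC)).pow_const q).ennreal_ofReal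
  -- Triangle inequality and convexity of the `q`-th power; the two restrictions together turn `2 ^
  -- (q - 1)` into `2 ^ q`.
  have h3 : ∀ ω, ENNReal.ofReal (specNorm (B ω) ^ q) ≤ ENNReal.ofReal (2 ^ (q - 1)) *
      (ENNReal.ofReal (specNorm (restrictTo s (signed e (B ω))) ^ q) +
        ENNReal.ofReal (specNorm (restrictTo sᶜ (signed e (B ω))) ^ q)) := by
    intro ω
    have hn1 := specNorm_nonneg (restrictTo s (signed e (B ω)))
    have hn2 := specNorm_nonneg (restrictTo sᶜ (signed e (B ω)))
    rw [← ENNReal.ofReal_add (Real.rpow_nonneg hn1 _) (Real.rpow_nonneg hn2 _),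
      ← ENNReal.ofReal_mul (by positivity)]
    refine ENNReal.ofReal_le_ofReal ?_
    have h4 := specNorm_add_le (restrictTo s (B ω)) (restrictTo sᶜ (B ω))
    rw [restrictTo_add_restrictTo_compl, e1, e2, specNorm_neg] at h4
    exact (Real.rpow_le_rpow (specNorm_nonneg _) h4 (by linarith)).trans
      (by exact_mod_cast NNReal.rpow_add_le_mul_rpow_add_rpow ⟨_, hn1⟩ ⟨_, hn2⟩ hq)
  refine (lintegral_mono h3).trans ?_
  rw [lintegral_const_mul' _ _ ENNReal.ofReal_ne_top, lintegral_add_left hm1]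
  refine (mul_le_mul_right (add_le_add h1 h2) _).trans (le_of_eq ?_)
  rw [← two_mul, ← mul_assoc]
  congr 1
  rw [← ENNReal.ofReal_ofNat, ← ENNReal.ofReal_mul (by positivity)]
  congr 1
  rw [Real.rpow_sub_one (by norm_num)]
  ring

/-! ### From signed tensors to moments of the random tensor -/

lemma rpow_fiber_le_maxFiber {d n : ℕ} (q : ℝ) (j : Fin d) (T : Tensor d n)
    (i : Fin d → Fin n) :
    (∑ a : Fin n, (T (Function.update i j a)) ^ 2) ^ (q / 2) ≤ maxFiber q j T :=
  le_ciSup (f := fun i : Fin d → Fin n =>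
    (∑ a : Fin n, (T (Function.update i j a)) ^ 2) ^ (q / 2)) (Set.finite_range _).bddAbove i

lemma maxFiber_nonneg {d n : ℕ} (q : ℝ) (j : Fin d) (T : Tensor d n) : 0 ≤ maxFiber q j T :=
  Real.iSup_nonneg fun _ => Real.rpow_nonneg (Finset.sum_nonneg fun _ _ => sq_nonneg _) _

lemma measurable_maxFiber {d n : ℕ} (q : ℝ) (j : Fin d) :
    Measurable (maxFiber q j : Tensor d n → ℝ) := by
  refine Measurable.iSup fun i => Measurable.pow_const ?_ _
  exact Finset.measurable_sum _ fun a _ => (measurable_pi_apply _).pow_const 2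

/-- The constant in front of the moments of the fibers. -/
noncomputable def signedConst (d n : ℕ) (q : ℝ) : ℝ :=
  12 * d * Real.sqrt (4 / 3 * 5 ^ (d - 1) * (5 * d * Real.log (2 * d * n * (n + 1)) + q))

lemma signedConst_nonneg (d n : ℕ) (q : ℝ) : 0 ≤ signedConst d n q := by
  unfold signedConst; positivity

lemma sum_specNorm_signed_rpow_le_maxFiber {d n : ℕ} (hd : 1 ≤ d) (hn : 1 ≤ n) (T : Tensor d n)
    {q : ℝ} (hq : 1 ≤ q) :
    ∑ e, specNorm (signed e T) ^ q ≤ 2 ^ Fintype.card (Fin d → Fin n) *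
      signedConst d n q ^ q * ∑ j, maxFiber q j T := by
  have hq0 : 0 < q := by linarith
  have hS : 0 ≤ ∑ j, maxFiber q j T := Finset.sum_nonneg fun j _ => maxFiber_nonneg q j T
  set S := ∑ j, maxFiber q j T
  -- `S ^ (1 / q)` serves as the common fiber bound `R`, since the `q`-th power of every fiber norm
  -- is at most `S`.
  have hR : ∀ j i, ∑ a : Fin n, (T (Function.update i j a)) ^ 2 ≤ (S ^ (1 / q)) ^ 2 := by
    intro j i
    have h1 : (∑ a : Fin n, (T (Function.update i j a)) ^ 2) ^ (q / 2) ≤ S :=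
      (rpow_fiber_le_maxFiber q j T i).trans
        (Finset.single_le_sum (f := fun j => maxFiber q j T)
          (fun j _ => maxFiber_nonneg q j T) (Finset.mem_univ j))
    have hf : 0 ≤ ∑ a : Fin n, (T (Function.update i j a)) ^ 2 :=
      Finset.sum_nonneg fun _ _ => sq_nonneg _
    have h2 := Real.rpow_le_rpow (Real.rpow_nonneg hf _) h1 (by positivity : 0 ≤ 2 / q)
    rw [← Real.rpow_mul hf, div_mul_div_cancel₀ (by norm_num : (2 : ℝ) ≠ 0), div_self hq0.ne',
      Real.rpow_one] at h2
    refine h2.trans (le_of_eq ?_)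
    rw [← Real.rpow_natCast, ← Real.rpow_mul hS]
    congr 1
    push_cast
    ring
  refine (sum_specNorm_signed_rpow_le hd hn T _ (Real.rpow_nonneg hS _) hR hq).trans (le_of_eq ?_)
  rw [← signedConst, Real.mul_rpow (signedConst_nonneg d n q) (Real.rpow_nonneg hS _),
    ← Real.rpow_mul hS, one_div_mul_cancel hq0.ne', Real.rpow_one, mul_assoc]

/-- The symmetrization bound holds for each deterministic sign pattern, so it is summed over all of
them and the sum moved under the integral. No auxiliary probability space is needed, and the number
of patterns cancels. -/
lemma lintegral_specNorm_rpow_le [IsProbabilityMeasure P] (hd : 1 ≤ d) (hn : 1 ≤ n)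
    {B : Ω → Tensor d n} (hB : ∀ i, Measurable (fun ω => B ω i))
    (hind : iIndepFun (fun i ω => B ω i) P) (hint : ∀ i, Integrable (fun ω => B ω i) P)
    (hmean : ∀ i, ∫ ω, B ω i ∂P = 0) {q : ℝ} (hq : 1 ≤ q) :
    ∫⁻ ω, ENNReal.ofReal (specNorm (B ω) ^ q) ∂P ≤
      ENNReal.ofReal ((2 * signedConst d n q) ^ q) *
        ∑ j : Fin d, ∫⁻ ω, ENNReal.ofReal (maxFiber q j (B ω)) ∂P := by
  have hBm : Measurable B := measurable_pi_lambda _ hB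
  have hcard : ∑ _e : (Fin d → Fin n) → Bool, (1 : ENNReal) =
      ENNReal.ofReal (2 ^ Fintype.card (Fin d → Fin n)) := by
    simp [ENNReal.ofReal_pow]
  have hsm : ∀ e : (Fin d → Fin n) → Bool,
      Measurable (fun ω => ENNReal.ofReal (specNorm (signed e (B ω)) ^ q)) := by
    intro e
    have : Measurable (fun ω => signed e (B ω)) :=
      measurable_pi_lambda _ fun i => (hB i).const_mul _
    exact ((measurable_specNorm.comp this).pow_const q).ennreal_ofReal
  have h1 : ENNReal.ofReal (2 ^ Fintype.card (Fin d → Fin n)) *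
      ∫⁻ ω, ENNReal.ofReal (specNorm (B ω) ^ q) ∂P ≤
      ENNReal.ofReal (2 ^ q) * ∑ e, ∫⁻ ω, ENNReal.ofReal (specNorm (signed e (B ω)) ^ q) ∂P := by
    rw [← hcard, Finset.sum_mul, Finset.mul_sum]
    refine Finset.sum_le_sum fun e _ => ?_
    rw [one_mul]
    exact lintegral_specNorm_le_signed hB hind hint hmean hq e
  have h2 : ∑ e, ∫⁻ ω, ENNReal.ofReal (specNorm (signed e (B ω)) ^ q) ∂P ≤
      ENNReal.ofReal (2 ^ Fintype.card (Fin d → Fin n) * signedConst d n q ^ q) *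
        ∑ j : Fin d, ∫⁻ ω, ENNReal.ofReal (maxFiber q j (B ω)) ∂P := by
    have hfm : ∀ j, Measurable (fun ω => ENNReal.ofReal (maxFiber q j (B ω))) :=
      fun j => ((measurable_maxFiber q j).comp hBm).ennreal_ofReal
    rw [← lintegral_finsetSum _ fun e _ => hsm e, ← lintegral_finsetSum _ fun j _ => hfm j,
      ← lintegral_const_mul' _ _ ENNReal.ofReal_ne_top]
    refine lintegral_mono fun ω => ?_
    rw [← ENNReal.ofReal_sum_of_nonneg fun e _ => Real.rpow_nonneg (specNorm_nonneg _) _,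
      ← ENNReal.ofReal_sum_of_nonneg fun j _ => maxFiber_nonneg q j (B ω),
      ← ENNReal.ofReal_mul (mul_nonneg (by positivity)
        (Real.rpow_nonneg (signedConst_nonneg d n q) _))]
    exact ENNReal.ofReal_le_ofReal (sum_specNorm_signed_rpow_le_maxFiber hd hn (B ω) hq)
  have h3 := h1.trans (mul_le_mul_right h2 _)
  have hpos : ENNReal.ofReal (2 ^ Fintype.card (Fin d → Fin n)) ≠ 0 := by
    rw [Ne, ENNReal.ofReal_eq_zero, not_le]; positivity
  refine (ENNReal.mul_le_mul_iff_right hpos ENNReal.ofReal_ne_top).1 (h3.trans (le_of_eq ?_))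
  rw [← mul_assoc, ← mul_assoc, ← ENNReal.ofReal_mul (by positivity),
    ← ENNReal.ofReal_mul (by positivity),
    Real.mul_rpow (by norm_num) (signedConst_nonneg d n q)]
  congr 2
  ring

lemma normMoment_le [IsProbabilityMeasure P] (hd : 1 ≤ d) (hn : 1 ≤ n)
    {B : Ω → Tensor d n} (hB : ∀ i, Measurable (fun ω => B ω i))
    (hind : iIndepFun (fun i ω => B ω i) P) (hint : ∀ i, Integrable (fun ω => B ω i) P)
    (hmean : ∀ i, ∫ ω, B ω i ∂P = 0) {q : ℝ} (hq : 1 ≤ q) :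
    normMoment P q B ≤ ENNReal.ofReal (2 * signedConst d n q) * fiberMoment P q B := by
  have hq0 : 0 < q := by linarith
  have hc := signedConst_nonneg d n q
  have h := ENNReal.rpow_le_rpow (lintegral_specNorm_rpow_le hd hn hB hind hint hmean hq)
    (by positivity : 0 ≤ 1 / q)
  rw [ENNReal.mul_rpow_of_nonneg _ _ (by positivity : 0 ≤ 1 / q),
    ENNReal.ofReal_rpow_of_nonneg (by positivity) (by positivity),
    ← Real.rpow_mul (by positivity), mul_one_div_cancel hq0.ne', Real.rpow_one] at h
  exact h

/-! ### The numerical constant -/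

lemma sq_le_two_mul_three_pow (m : ℕ) : ((m : ℝ) + 1) ^ 2 ≤ 2 * 3 ^ m := by
  induction m with
  | zero => norm_num
  | succ m ih =>
    rcases Nat.eq_zero_or_pos m with rfl | hm
    · norm_num
    · have : (1 : ℝ) ≤ m := by exact_mod_cast hm
      push_cast
      rw [pow_succ (3 : ℝ)]
      nlinarith

/-- The exponential growth is only `√5 ^ (d - 1)`. Since `√5 ≤ 8 / 3`, a factor `3 ^ (d - 1)` is
left below `8 ^ (d - 1)`, and it absorbs the two polynomial factors `d`: one from the prefactor, one
from `log d` and the dimension under the root. -/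
lemma two_mul_signedConst_le (hd : 1 ≤ d) (hn : 1 ≤ n) {q : ℝ} (hq : 1 ≤ q) :
    2 * signedConst d n q ≤
      300 * 2 ^ (3 * (d - 1)) * (Real.sqrt (d * Real.log n) + Real.sqrt q) := by
  obtain ⟨m, rfl⟩ : ∃ m, d = m + 1 := ⟨d - 1, by omega⟩
  have hsq := sq_le_two_mul_three_pow m
  unfold signedConst
  rw [Nat.add_sub_cancel]
  push_cast
  have hd' : (1 : ℝ) ≤ (m : ℝ) + 1 := by exact_mod_cast hd
  generalize (m : ℝ) + 1 = D at hsq hd'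
  have hn' : (1 : ℝ) ≤ n := by exact_mod_cast hn
  have hlog : 0 ≤ Real.log n := Real.log_nonneg hn'
  have hl : Real.log (2 * D * n * (n + 1)) ≤ 2 * Real.log n + 4 * D := by
    calc Real.log (2 * D * n * (n + 1)) ≤ Real.log (4 * D * (n * n)) := by
          refine Real.log_le_log (by positivity) ?_
          have : D * n ≤ D * n * n := le_mul_of_one_le_right (by positivity) hn'
          nlinarith
      _ = Real.log (4 * D) + 2 * Real.log n := by
          rw [Real.log_mul (by positivity) (by positivity),
            Real.log_mul (x := (n : ℝ)) (by positivity) (by positivity)]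
          ring
      _ ≤ _ := by linarith [Real.log_le_sub_one_of_pos (by positivity : 0 < 4 * D)]
  have h1 : 5 * D * Real.log (2 * D * n * (n + 1)) + q ≤ 21 * D ^ 2 * (D * Real.log n + q) := by
    have e1 : 5 * D * Real.log (2 * D * n * (n + 1)) ≤ 5 * D * (2 * Real.log n + 4 * D) :=
      mul_le_mul_of_nonneg_left hl (by positivity)
    have hD2 : 1 ≤ D ^ 2 := one_le_pow₀ hd'
    have e2 : D * Real.log n ≤ D ^ 2 * (D * Real.log n) :=
      le_mul_of_one_le_left (by positivity) hD2
    have e3 : q ≤ D ^ 2 * q := le_mul_of_one_le_left (by linarith) hD2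
    have e4 : D ^ 2 ≤ D ^ 2 * q := le_mul_of_one_le_right (by linarith) hq
    have e5 : 0 ≤ D ^ 2 * (D * Real.log n) := by positivity
    nlinarith
  have h2 : Real.sqrt (D * Real.log n + q) ≤ Real.sqrt (D * Real.log n) + Real.sqrt q :=
    Real.sqrt_le_iff.2 ⟨by positivity, by
      nlinarith [Real.sq_sqrt (by positivity : 0 ≤ D * Real.log n),
        Real.sq_sqrt (by linarith : 0 ≤ q),
        mul_nonneg (Real.sqrt_nonneg (D * Real.log n)) (Real.sqrt_nonneg q)]⟩
  have h3 : 2 * (12 * D * Real.sqrt (4 / 3 * 5 ^ m *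
      (5 * D * Real.log (2 * D * n * (n + 1)) + q))) ≤
      300 * 2 ^ (3 * m) * Real.sqrt (D * Real.log n + q) := by
    have e1 : 4 / 3 * 5 ^ m * (5 * D * Real.log (2 * D * n * (n + 1)) + q) ≤
        (2 * 3 * D) ^ 2 * 5 ^ m * (D * Real.log n + q) := by
      have : 0 ≤ (5 : ℝ) ^ m * (D ^ 2 * (D * Real.log n + q)) := by positivity
      have := mul_le_mul_of_nonneg_left h1 (by positivity : (0 : ℝ) ≤ 4 / 3 * 5 ^ m)
      nlinarith
    have e2 : Real.sqrt (4 / 3 * 5 ^ m * (5 * D * Real.log (2 * D * n * (n + 1)) + q)) ≤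
        2 * 3 * D * (Real.sqrt (5 ^ m) * Real.sqrt (D * Real.log n + q)) := by
      refine (Real.sqrt_le_sqrt e1).trans (le_of_eq ?_)
      rw [mul_assoc, Real.sqrt_mul (by positivity), Real.sqrt_sq (by positivity),
        Real.sqrt_mul (by positivity)]
    have e3 : Real.sqrt (5 ^ m) ≤ (8 / 3) ^ m := by
      refine Real.sqrt_le_iff.2 ⟨by positivity, ?_⟩
      rw [← pow_mul, mul_comm, pow_mul]
      exact pow_le_pow_left₀ (by norm_num) (by norm_num) m
    have e4 : (2 : ℝ) ^ (3 * m) = 3 ^ m * (8 / 3) ^ m := by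
      rw [pow_mul, ← mul_pow]; norm_num
    have hs : 0 ≤ Real.sqrt (D * Real.log n + q) := Real.sqrt_nonneg _
    calc _ ≤ 2 * (12 * D * (2 * 3 * D * ((8 / 3) ^ m * Real.sqrt (D * Real.log n + q)))) := by
          refine mul_le_mul_of_nonneg_left (mul_le_mul_of_nonneg_left (e2.trans ?_)
            (by positivity)) (by norm_num)
          gcongr
      _ = 144 * D ^ 2 * (8 / 3) ^ m * Real.sqrt (D * Real.log n + q) := by ring
      _ ≤ 144 * (2 * 3 ^ m) * (8 / 3) ^ m * Real.sqrt (D * Real.log n + q) := by gcongr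
      _ = 288 * 2 ^ (3 * m) * Real.sqrt (D * Real.log n + q) := by rw [e4]; ring
      _ ≤ _ := by gcongr; norm_num
  exact h3.trans (mul_le_mul_of_nonneg_left h2 (by positivity))

/-! ### Entrywise sampling -/

lemma keepProb_nonneg (s : ℝ) (hs : 0 < s) (A : Tensor d n) (i : Fin d → Fin n) :
    0 ≤ keepProb s A i :=
  le_min zero_le_one (by positivity)

/-- An entry that is never kept is zero already in the tensor. -/
lemma largePart_eq_zero_of_keepProb_eq_zero {s : ℝ} (hs : 0 < s) {A : Tensor d n}
    {i : Fin d → Fin n} (h : keepProb s A i = 0) : largePart s A i = 0 := by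
  have hA : A i = 0 := by
    by_contra hne
    have hF : 0 < frobNorm A ^ 2 := by
      rw [frobNorm, Real.sq_sqrt (Finset.sum_nonneg fun _ _ => sq_nonneg _)]
      exact (by positivity : 0 < A i ^ 2).trans_le
        (Finset.single_le_sum (f := fun i => A i ^ 2) (fun _ _ => sq_nonneg _)
          (Finset.mem_univ i))
    have : 0 < keepProb s A i := lt_min zero_lt_one (by positivity)
    exact this.ne' h
  simp [largePart, hA]

/-- A random variable that takes the values one and zero with probabilities `p` and `1 - p`
is integrable with mean `p`. -/
lemma integrable_and_integral_of_bernoulli [IsProbabilityMeasure P] {f : Ω → ℝ}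
    (hf : Measurable f) {p : ℝ} (hp0 : 0 ≤ p) (hp1 : p ≤ 1)
    (h1 : P {ω | f ω = 1} = ENNReal.ofReal p) (h0 : P {ω | f ω = 0} = ENNReal.ofReal (1 - p)) :
    Integrable f P ∧ ∫ ω, f ω ∂P = p := by
  have hm1 : MeasurableSet {ω | f ω = 1} := hf (measurableSet_singleton 1)
  have hm0 : MeasurableSet {ω | f ω = 0} := hf (measurableSet_singleton 0)
  have hdisj : Disjoint {ω | f ω = 1} {ω | f ω = 0} := by
    rw [Set.disjoint_left]
    intro ω h h'
    simp only [Set.mem_ofPred_eq] at h h'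
    norm_num [h] at h'
  have hunion : P ({ω | f ω = 1} ∪ {ω | f ω = 0}) = 1 := by
    rw [measure_union hdisj hm0, h1, h0, ← ENNReal.ofReal_add hp0 (by linarith)]
    simp
  have hae : f =ᵐ[P] Set.indicator {ω | f ω = 1} (fun _ => (1 : ℝ)) := by
    have h : ∀ᵐ ω ∂P, ω ∈ {ω | f ω = 1} ∪ {ω | f ω = 0} :=
      (prob_compl_eq_zero_iff (hm1.union hm0)).2 hunion
    filter_upwards [h] with ω hω
    rcases hω with h | h
    · rw [Set.indicator_of_mem h]; exact h
    · have h' : f ω = 0 := h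
      rw [Set.indicator_of_notMem (by simp [h']), h']
  refine ⟨(((integrable_const (1 : ℝ)).indicator hm1)).congr hae.symm, ?_⟩
  rw [integral_congr_ae hae, integral_indicator hm1]
  simp [Measure.real, h1, ENNReal.toReal_ofReal hp0]

end RandomTensor

theorem mainTheorem2 :
    ∃ c₁ : ℝ, 0 < c₁ ∧
      ∀ (d n : ℕ), 1 ≤ d → 1 ≤ n → ∀ q : ℝ, 1 ≤ q →
      ∀ (Ω : Type*) [MeasurableSpace Ω] (P : Measure Ω) [IsProbabilityMeasure P],
        (∀ B : Ω → RandomTensor.Tensor d n,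
          (∀ i, Measurable (fun ω => B ω i)) →
          iIndepFun (fun i ω => B ω i) P →
          (∀ i, Integrable (fun ω => B ω i) P) →
          (∀ i, ∫ ω, B ω i ∂P = 0) →
          RandomTensor.normMoment P q B ≤
            ENNReal.ofReal (c₁ * 2 ^ (3 * (d - 1)) *
              (Real.sqrt (d * Real.log n) + Real.sqrt q)) *
            RandomTensor.fiberMoment P q B) ∧
        (∀ (A : RandomTensor.Tensor d n) (s : ℝ), 0 < s →
          ∀ δ : Ω → (Fin d → Fin n) → ℝ,
          (∀ i, Measurable (fun ω => δ ω i)) →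
          iIndepFun (fun i ω => δ ω i) P →
          (∀ i, P {ω | δ ω i = 1} = ENNReal.ofReal (RandomTensor.keepProb s A i)) →
          (∀ i, P {ω | δ ω i = 0} = ENNReal.ofReal (1 - RandomTensor.keepProb s A i)) →
          ∀ B : Ω → RandomTensor.Tensor d n,
          (∀ ω, B ω =
            RandomTensor.largePart s A - RandomTensor.sampledLargePart s A (δ ω)) →
          RandomTensor.normMoment P q B ≤
            ENNReal.ofReal (c₁ * 2 ^ (3 * (d - 1)) *
              (Real.sqrt (d * Real.log n) + Real.sqrt q)) *
            RandomTensor.fiberMoment P q B) := by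
  refine ⟨300, by norm_num, fun d n hd hn q hq Ω _ P _ => ?_⟩
  have main : ∀ B : Ω → RandomTensor.Tensor d n,
      (∀ i, Measurable (fun ω => B ω i)) → iIndepFun (fun i ω => B ω i) P →
      (∀ i, Integrable (fun ω => B ω i) P) → (∀ i, ∫ ω, B ω i ∂P = 0) →
      RandomTensor.normMoment P q B ≤ ENNReal.ofReal (300 * 2 ^ (3 * (d - 1)) *
        (Real.sqrt (d * Real.log n) + Real.sqrt q)) * RandomTensor.fiberMoment P q B :=
    fun B hB hind hint hmean => (RandomTensor.normMoment_le hd hn hB hind hint hmean hq).trans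
      (mul_le_mul_left
        (ENNReal.ofReal_le_ofReal (RandomTensor.two_mul_signedConst_le hd hn hq)) _)
  refine ⟨main, ?_⟩
  intro A s hs δ hδ hind h1 h0 B hB
  obtain rfl : B = fun ω => RandomTensor.largePart s A -
      RandomTensor.sampledLargePart s A (δ ω) := funext hB
  have hber := fun i => RandomTensor.integrable_and_integral_of_bernoulli (hδ i)
    (RandomTensor.keepProb_nonneg s hs A i) (min_le_left _ _) (h1 i) (h0 i)
  refine main _ (fun i => ?_) ?_ (fun i => ?_) (fun i => ?_)
  · exact measurable_const.sub (((hδ i).mul_const _).div_const _)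
  · exact hind.comp (fun i t => RandomTensor.largePart s A i -
      t * RandomTensor.largePart s A i / RandomTensor.keepProb s A i) fun i =>
        measurable_const.sub ((measurable_id.mul_const _).div_const _)
  · exact (integrable_const _).sub (((hber i).1.mul_const _).div_const _)
  · simp only [Pi.sub_apply, RandomTensor.sampledLargePart]
    rw [integral_sub (integrable_const _) (((hber i).1.mul_const _).div_const _),
      integral_div, integral_mul_const, (hber i).2]
    -- The rescaled entry is unbiased when `p ≠ 0`. When `p = 0` division by zero yields zero, which
    -- is harmless because the entry of `largePart` vanishes as well.
    by_cases hp : RandomTensor.keepProb s A i = 0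
    · simp [RandomTensor.largePart_eq_zero_of_keepProb_eq_zero hs hp]
    · simp [mul_div_cancel_left₀ _ hp]
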